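/- Let $n\ge 0$ be an integer and let $z=(z_1,\dots,z_n)$, $\bar z=(\bar z_1,\dots,\bar z_n)$ be $2n$ independent complex variables, $\mathbf z=(z,\bar z)\in\mathbb C^{2n}$. Write $z^k\bar z^{\bar k}$ for monomials ($k,\bar k\in\mathbb Z_{\ge0}^n$), $|q|=\sum_j|q_j|$ for the $\ell^1$-norm, and $D_r=\{\mathbf z:\ |z_j|<r,\ |\bar z_j|<r\ \text{for all } j\}$; say that a series belongs to $\mathcal A^r$ if it converges absolutely on $D_r$ to a bounded function, and put $\|H\|_r=\sup_{D_r}|H|$. Let $\omega\in\mathbb R^n$ be nonresonant: $\langle\omega,q\rangle\ne0$ for all $q\in\mathbb Z^n\setminus\{0\}$. Put $H_2=\sum_j\omega_jz_j\bar z_j$, $\omega_q=|\langle\omega,q\rangle|$ and $$\{F,G\}=i\sum_{j=1}^n\big(\partial_{\bar z_j}F\,\partial_{z_j}G-\partial_{z_j}F\,\partial_{\bar z_j}G\big).$$ For a formal power series $H=\sum H_{k,\bar k}z^k\bar z^{\bar k}$ with complex coefficients let $H^q=\sum_{\bar k-k=q}H_{k,\bar k}z^k\bar z^{\bar k}$ ($q\in\mathbb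 Z^n$) be its harmonics, and $\xi H=-i\sum\operatorname{sign}(\langle\omega,\bar k-k\rangle)H_{k,\bar k}z^k\bar z^{\bar k}$. The normalization flow $\phi^\delta$, $\delta\ge0$, on the space of formal series without terms of degree less than $3$ is given by the initial value problem (understood coefficientwise) $$\partial_\delta H=-\{\xi H,\,H_2+H\},\qquad H|_{\delta=0}=\widehat H_\diamond,\qquad \phi^\delta(\widehat H_\diamond)=H(\cdot,\delta).$$ **Proposition.** Let $\widehat H_\diamond$ be a formal series without terms of degree less than $3$ which is analytic, i.e. $|\widehat H_{k,\bar k}|\le c\,e^{a(|k|+|\bar k|)}$ for some constants $c,a$ and all $k,\bar k$. Let $S=\{q\in\mathbb Z^n:\widehat H^q\ne0\}$. Suppose that $S\subset\{q:\langle\omega,q\rangle\ge0\}$ and $$c_S:=\inf_{q\in S\setminus\{0\}}\omega_q/|q|>0\qquad(\inf\emptyset=+\infty).$$ Then $\widehat H_\diamond$ is transformed to the normal form $\widehat H^0$ by an analytic canonical transformation, which is the limit of the changes of variables defining the normalization flow. More precisely, the initial value problem has a unique solution $\phi^\delta(\widehat H_\diamond)$, $\delta\ge0$, and there are $R\ge\rho>0$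 such that: 1. $\widehat H^0\in\mathcal A^R$, $\phi^\delta(\widehat H_\diamond)\in\mathcal A^R$ for all $\delta\ge0$, and $\|\phi^\delta(\widehat H_\diamond)-\widehat H^0\|_R\to0$ as $\delta\to+\infty$. 2. For every initial point $\mathbf z\in D_\rho$ the Hamiltonian system $z'=i\partial_{\bar z}F$, $\bar z'=-i\partial_zF$ with $F=\xi\phi^\delta(\widehat H_\diamond)$ and independent variable $\delta$ has a solution $\mathbf z_\delta\in D_R$, $\mathbf z_0=\mathbf z$, for all $\delta\ge0$. As $\delta\to+\infty$ the maps $\mathbf z\mapsto\mathbf z_\delta$ converge uniformly on $D_\rho$ to a map $\mathbf z\mapsto\mathbf z_{+\infty}$ from $D_\rho$ to $D_R$. 3. The map $\mathbf z\mapsto\mathbf z_{+\infty}$ is analytic and injective on $D_\rho$, preserves the form $\sum_jd\bar z_j\wedge dz_j$, fixes the origin and has identity derivative there, and $$H_2(\mathbf z)+\widehat H_\diamond(\mathbf z)=H_2(\mathbf z_{+\infty})+\widehat H^0(\mathbf z_{+\infty}),\qquad \mathbf z\in D_\rho.$$ -/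

import Mathlib

open Set Filter Topology

noncomputable section

namespace NormalizationFlow

/-- Index set of the `2n` independent coordinates: `Sum.inl j` is `z_j`, `Sum.inr j` is `z̄_j`. -/
abbrev Var (n : ℕ) : Type := Fin n ⊕ Fin n

/-- The phase space `ℂ^{2n}` with the independent coordinates `z`, `z̄`. -/
abbrev Phase (n : ℕ) : Type := Var n → ℂ

/-- The space of all formal power series in `z`, `z̄`. -/
abbrev Series (n : ℕ) : Type := MvPowerSeries (Var n) ℂ

/-- For a multi-index `(k, k̄)`, the integer vector `k̄ - k`. -/
def harmonicIndex {n : ℕ} (k : Var n →₀ ℕ) : Fin n → ℤ :=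
  fun j => (k (Sum.inr j) : ℤ) - (k (Sum.inl j) : ℤ)

/-- The inner product `⟨ω, q⟩`. -/
def pairing {n : ℕ} (ω : Fin n → ℝ) (q : Fin n → ℤ) : ℝ := ∑ j, ω j * (q j : ℝ)

/-- The `ℓ¹`-norm of an integer vector. -/
def l1 {n : ℕ} (q : Fin n → ℤ) : ℝ := ∑ j, |(q j : ℝ)|

/-- Nonresonance of the frequency vector. -/
def Nonresonant {n : ℕ} (ω : Fin n → ℝ) : Prop :=
  ∀ q : Fin n → ℤ, q ≠ 0 → pairing ω q ≠ 0

/-- Series all of whose terms have degree at least `3`. -/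
def Cubic (n : ℕ) : Set (Series n) :=
  {H | ∀ k : Var n →₀ ℕ, k.degree < 3 → MvPowerSeries.coeff k H = 0}

/-- Analytic series: the coefficients grow at most exponentially in the degree. -/
def Analytic (n : ℕ) : Set (Series n) :=
  {H | ∃ c a : ℝ, ∀ k : Var n →₀ ℕ,
    ‖MvPowerSeries.coeff k H‖ ≤ c * Real.exp (a * (k.degree : ℝ))}

/-- The part of a series carried by the multi-indices with `k̄ - k = q`. -/
def harmonic {n : ℕ} (q : Fin n → ℤ) (H : Series n) : Series n :=
  fun k => if harmonicIndex k = q then MvPowerSeries.coeff k H else 0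

/-- The set of all `q` with a nonvanishing harmonic. -/
def support {n : ℕ} (H : Series n) : Set (Fin n → ℤ) := {q | harmonic q H ≠ 0}

/-- The infimum of `|⟨ω, q⟩| / |q|` over the nonzero `q` whose harmonic does not vanish
(it is `⊤` if there are none). -/
def smallDivisorInf {n : ℕ} (ω : Fin n → ℝ) (H : Series n) : EReal :=
  ⨅ q ∈ support H \ {0}, ((|pairing ω q| / l1 q : ℝ) : EReal)

/-- The quadratic Hamiltonian `∑ ω_j z_j z̄_j`. -/
def quadratic {n : ℕ} (ω : Fin n → ℝ) : Series n :=
  ∑ j, MvPowerSeries.C (ω j : ℂ) * MvPowerSeries.X (Sum.inl j) * MvPowerSeries.X (Sum.inr j)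

/-- The Poisson bracket `i ∑ (∂F/∂z̄_j ∂G/∂z_j - ∂F/∂z_j ∂G/∂z̄_j)`. -/
def poisson {n : ℕ} (F G : Series n) : Series n :=
  MvPowerSeries.C Complex.I * ∑ j,
    (MvPowerSeries.pderiv ℂ (Sum.inr j) F * MvPowerSeries.pderiv ℂ (Sum.inl j) G
      - MvPowerSeries.pderiv ℂ (Sum.inl j) F * MvPowerSeries.pderiv ℂ (Sum.inr j) G)

/-- The averaging operator `ξ`, multiplication of the coefficient at `(k, k̄)` by
`-i sign ⟨ω, k̄ - k⟩`. -/
def xi {n : ℕ} (ω : Fin n → ℝ) (H : Series n) : Series n :=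
  fun k => -Complex.I * ((Real.sign (pairing ω (harmonicIndex k)) : ℝ) : ℂ)
    * MvPowerSeries.coeff k H

/-- `γ` solves `∂_δ H = -{ξ H, H₂ + H}`, `H|_{δ=0} = H₀`, coefficient by coefficient, on
`[0, ∞)`, in the space of series without terms of degree less than `3`. -/
structure IsNormalizationOrbit {n : ℕ} (ω : Fin n → ℝ) (H₀ : Series n) (γ : ℝ → Series n) :
    Prop where
  initial : γ 0 = H₀
  mem_cubic : ∀ δ : ℝ, 0 ≤ δ → γ δ ∈ Cubic n
  equation : ∀ δ : ℝ, 0 ≤ δ → ∀ k : Var n →₀ ℕ,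
    HasDerivWithinAt (fun s => MvPowerSeries.coeff k (γ s))
      (MvPowerSeries.coeff k (-poisson (xi ω (γ δ)) (quadratic ω + γ δ))) (Ici 0) δ

/-- The open polydisk of radius `ρ` centred at the origin. -/
def polydisk (n : ℕ) (ρ : ℝ) : Set (Phase n) := {x | ∀ i, ‖x i‖ < ρ}

/-- The term with multi-index `k` of the series `H` at the point `x`. -/
def term {n : ℕ} (H : Series n) (x : Phase n) (k : Var n →₀ ℕ) : ℂ :=
  MvPowerSeries.coeff k H * k.prod fun i m => x i ^ m

/-- The value of a series at a point where it converges absolutely. -/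
def value {n : ℕ} (H : Series n) (x : Phase n) : ℂ := ∑' k, term H x k

/-- The supremum norm over the polydisk of radius `ρ`. -/
def polydiskNorm {n : ℕ} (ρ : ℝ) (H : Series n) : ENNReal :=
  ⨆ x ∈ polydisk n ρ, ‖value H x‖ₑ

/-- Series converging to a bounded function on the polydisk of radius `ρ`. -/
def AnalyticOnPolydisk (n : ℕ) (ρ : ℝ) : Set (Series n) :=
  {H | (∀ x ∈ polydisk n ρ, Summable (term H x)) ∧ polydiskNorm ρ H < ⊤}

/-- The Hamiltonian vector field `z' = i ∂F/∂z̄`, `z̄' = -i ∂F/∂z`. -/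
def hamiltonianField {n : ℕ} (F : Series n) (x : Phase n) : Phase n :=
  Sum.elim (fun j => Complex.I * value (MvPowerSeries.pderiv ℂ (Sum.inr j) F) x)
    (fun j => -Complex.I * value (MvPowerSeries.pderiv ℂ (Sum.inl j) F) x)

/-- `Z δ` is, on the polydisk of radius `ρ`, the shift from time `0` to time `δ` along the
trajectories of the nonautonomous Hamiltonian system with Hamiltonian `F δ`; the trajectories
stay in the polydisk of radius `R`. -/
structure IsHamiltonianShift {n : ℕ} (F : ℝ → Series n) (ρ R : ℝ)
    (Z : ℝ → Phase n → Phase n) : Prop where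
  initial : ∀ x ∈ polydisk n ρ, Z 0 x = x
  mem_polydisk : ∀ x ∈ polydisk n ρ, ∀ δ : ℝ, 0 ≤ δ → Z δ x ∈ polydisk n R
  equation : ∀ x ∈ polydisk n ρ, ∀ δ : ℝ, 0 ≤ δ →
    HasDerivWithinAt (fun s => Z s x) (hamiltonianField (F δ) (Z δ x)) (Ici 0) δ

/-- The symplectic form `∑ dz̄_j ∧ dz_j`. -/
def symplecticForm {n : ℕ} (u v : Phase n) : ℂ :=
  ∑ j, (u (Sum.inr j) * v (Sum.inl j) - u (Sum.inl j) * v (Sum.inr j))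

/-- `T` is on `U` an analytic injective map which preserves the symplectic form. -/
structure IsAnalyticCanonical {n : ℕ} (T : Phase n → Phase n) (U : Set (Phase n)) : Prop where
  analytic : AnalyticOnNhd ℂ T U
  injective : InjOn T U
  symplectic : ∀ x ∈ U, ∀ u v : Phase n,
    symplecticForm (fderiv ℂ T x u) (fderiv ℂ T x v) = symplecticForm u v

end NormalizationFlow

end

noncomputable section

namespace NormalizationFlow

/-! ### Series with geometrically bounded coefficients -/

/-! The sign condition makes the quadratic flow linear. Let `N` be the zero harmonic. As long as the
support stays in the half-space `⟨ω, q⟩ ≥ 0`, nonresonance gives `ξ H = -i (H - N)`. Since `{H - N,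
H - N} = 0`, only the brackets of `H - N` with `H₂` and `N` survive. Both act inside each harmonic:
the harmonic `q` is multiplied by `i⟨ω, q⟩` and by `i⟨q, ∂N⟩`, where `∂` is the gradient in the
actions `z_j z̄_j`. So `N` is constant and the orbit is explicit: the harmonic `q` is multiplied by
`exp (-δ (⟨ω, q⟩ + ⟨q, ∂N⟩))` (`orbit`, `coeff_neg_poisson_orbit`). This keeps the support, so the
linearization is consistent. Uniqueness is an induction on the degree
(`IsNormalizationOrbit.unique`).

The series `∂N` has no constant term, so in a weighted `ℓ¹`-norm of small radius `⟨q, ∂N⟩` is at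
most `c |q| / 2`, while `⟨ω, q⟩ ≥ c |q|` by the small divisor condition. The norm is
submultiplicative, so the exponential of the series is controlled by that of its norm. Hence `H - N`
decays like `exp (-c δ / 2)` in a fixed polydisk (`exists_coeffBound_orbit`).

The Hamiltonian `ξ H` decays at the same rate `κ`. In the time `s = 1 - exp (-κ δ / 2)` it becomes a
Hamiltonian on `[0, 1]` that extends continuously by zero to `s = 1`, so the limit `δ → +∞` is a
time-one map. Near the origin the field is small (`exists_isSmallField`), and ODE theory gives
existence, injectivity, complex differentiability through the variational equation, and invariance
of the symplectic form. Osgood's lemma turns differentiability into analyticity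
(`analyticOnNhd_of_differentiableOn`). Finally `H₂ + H` is constant along trajectories
(`value_eq_of_transport`), and letting `δ → +∞` gives the conjugation to `H₂ + N`. -/

lemma summable_pow_degree {ι : Type*} [Fintype ι] {t : ℝ} (h0 : 0 ≤ t) (h1 : t < 1) :
    Summable fun k : ι →₀ ℕ => t ^ k.degree := by
  classical
  have key : Summable fun f : ι → ℕ => ∏ i, t ^ f i := by
    refine summable_of_sum_le (c := ∏ _i : ι, (1 - t)⁻¹)
      (fun f => Finset.prod_nonneg fun i _ => pow_nonneg h0 _) fun s => ?_
    -- All exponents occurring in `s` are below `M`, so `s` lies in a box, over which the sum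
    -- factors into truncated geometric series.
    set M := s.sup (fun f => Finset.univ.sup f) + 1 with hM
    have hs : s ⊆ Fintype.piFinset fun _ : ι => Finset.range M := by
      intro f hf
      rw [Fintype.mem_piFinset]
      intro i
      rw [Finset.mem_range, hM, Nat.lt_succ_iff]
      exact (Finset.le_sup (f := f) (Finset.mem_univ i)).trans
        (Finset.le_sup (f := fun f : ι → ℕ => Finset.univ.sup f) hf)
    calc ∑ f ∈ s, ∏ i, t ^ f i
        ≤ ∑ f ∈ Fintype.piFinset fun _ : ι => Finset.range M, ∏ i, t ^ f i :=
          Finset.sum_le_sum_of_subset_of_nonneg hs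
            fun f _ _ => Finset.prod_nonneg fun i _ => pow_nonneg h0 _
      _ = ∏ _i : ι, ∑ m ∈ Finset.range M, t ^ m :=
          (Finset.prod_univ_sum (fun _ : ι => Finset.range M) fun _ m => t ^ m).symm
      _ ≤ ∏ _i : ι, (1 - t)⁻¹ := by
          refine Finset.prod_le_prod (fun i _ => Finset.sum_nonneg fun m _ => pow_nonneg h0 _)
            fun i _ => ?_
          rw [← tsum_geometric_of_lt_one h0 h1]
          exact (summable_geometric_of_lt_one h0 h1).sum_le_tsum _ fun m _ => pow_nonneg h0 _
  refine (key.comp_injective (i := fun k : ι →₀ ℕ => (k : ι → ℕ)) DFunLike.coe_injective).congr ?_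
  intro k
  simp [Finsupp.degree_eq_sum, Finset.prod_pow_eq_pow_sum]

/-- The sum of the geometric series `∑ t ^ |k|` over all multi-indices. -/
def geom (n : ℕ) (t : ℝ) : ℝ := ∑' k : Var n →₀ ℕ, t ^ k.degree

lemma geom_nonneg (n : ℕ) {t : ℝ} (h0 : 0 ≤ t) : 0 ≤ geom n t :=
  tsum_nonneg fun _ => pow_nonneg h0 _

/-- The coefficients of `F` are at most `c * b ^ |k|`. -/
def CoeffBound {n : ℕ} (c b : ℝ) (F : Series n) : Prop :=
  ∀ k, ‖MvPowerSeries.coeff k F‖ ≤ c * b ^ k.degree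

namespace CoeffBound

variable {n : ℕ} {c c' b r : ℝ} {F G : Series n}

lemma nonneg (h : CoeffBound c b F) : 0 ≤ c := by
  simpa using (norm_nonneg _).trans (h 0)

lemma mono {b' : ℝ} (h : CoeffBound c b F) (hb : 0 ≤ b) (hc : c ≤ c') (hbb : b ≤ b') :
    CoeffBound c' b' F := fun k =>
  (h k).trans (by have := h.nonneg; have := this.trans hc; gcongr)

lemma add (hF : CoeffBound c b F) (hG : CoeffBound c' b G) : CoeffBound (c + c') b (F + G) :=
  fun k => by
    rw [map_add, add_mul]
    exact (norm_add_le _ _).trans (add_le_add (hF k) (hG k))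

lemma neg (hF : CoeffBound c b F) : CoeffBound c b (-F) := fun k => by
  rw [map_neg, norm_neg]; exact hF k

lemma sub (hF : CoeffBound c b F) (hG : CoeffBound c' b G) : CoeffBound (c + c') b (F - G) := by
  rw [sub_eq_add_neg]; exact hF.add hG.neg

lemma C_mul (a : ℂ) (hF : CoeffBound c b F) :
    CoeffBound (‖a‖ * c) b (MvPowerSeries.C a * F) := fun k => by
  rw [MvPowerSeries.coeff_C_mul, norm_mul, mul_assoc]
  exact mul_le_mul_of_nonneg_left (hF k) (norm_nonneg _)

lemma sum {ι : Type*} (s : Finset ι) {f : ι → Series n} {c : ι → ℝ}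
    (h : ∀ i ∈ s, CoeffBound (c i) b (f i)) : CoeffBound (∑ i ∈ s, c i) b (∑ i ∈ s, f i) :=
  fun k => by
    rw [map_sum, Finset.sum_mul]
    exact (norm_sum_le _ _).trans (Finset.sum_le_sum fun i hi => h i hi k)

/-- The factor `k i + 1` is absorbed by doubling the rate, and the index shift costs one factor `b`.
-/
lemma pderiv (h : CoeffBound c b F) (hb : 0 ≤ b) (i : Var n) :
    CoeffBound (c * b) (2 * b) (MvPowerSeries.pderiv ℂ i F) := fun k => by
  have h1 : (k i : ℝ) + 1 ≤ 2 ^ k.degree := by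
    have : k i + 1 ≤ 2 ^ k.degree :=
      (Nat.succ_le_succ (Finsupp.le_degree i k)).trans Nat.lt_two_pow_self
    exact_mod_cast this
  have h2 : ‖(k i : ℂ) + 1‖ = (k i : ℝ) + 1 := by
    rw [← Nat.cast_add_one, Complex.norm_natCast]; push_cast; rfl
  rw [MvPowerSeries.coeff_pderiv, norm_mul, h2]
  have h3 := h (k + Finsupp.single i 1)
  rw [map_add, Finsupp.degree_single, pow_succ] at h3
  have := h.nonneg
  calc _ ≤ (c * (b ^ k.degree * b)) * 2 ^ k.degree := by gcongr
    _ = c * b * (2 * b) ^ k.degree := by rw [mul_pow]; ring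

/-- There are at most `∏ (k i + 1) ≤ 2 ^ |k|` ways to split `k`, hence the doubled rate. -/
lemma mul (hF : CoeffBound c b F) (hG : CoeffBound c' b G) (hb : 0 ≤ b) :
    CoeffBound (c * c') (2 * b) (F * G) := fun k => by
  classical
  have hc := hF.nonneg
  have hc' := hG.nonneg
  have hcard : (Finset.HasAntidiagonal.antidiagonal k).card ≤ 2 ^ k.degree := by
    calc (Finset.HasAntidiagonal.antidiagonal k).card ≤ (Finset.Iic k).card := by
          refine Finset.card_le_card_of_injOn Prod.fst (fun p hp => ?_) (fun p hp q hq h => ?_)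
          · have hp' : p.1 + p.2 = k := Finset.HasAntidiagonal.mem_antidiagonal.mp hp
            simp only [Finset.coe_Iic, mem_Iic]
            exact hp' ▸ le_self_add
          · have hp' : p.1 + p.2 = k := Finset.HasAntidiagonal.mem_antidiagonal.mp hp
            have hq' : q.1 + q.2 = k := Finset.HasAntidiagonal.mem_antidiagonal.mp hq
            refine Prod.ext h ?_
            rw [← hq', h] at hp'
            exact add_left_cancel hp'
      _ = ∏ i ∈ k.support, (k i + 1) := by rw [Finsupp.card_Iic]; simp
      _ ≤ ∏ i ∈ k.support, 2 ^ k i := Finset.prod_le_prod' fun i _ => Nat.lt_two_pow_self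
      _ = 2 ^ k.degree := by rw [Finset.prod_pow_eq_pow_sum]; rfl
  rw [MvPowerSeries.coeff_mul]
  calc ‖∑ p ∈ Finset.HasAntidiagonal.antidiagonal k,
    MvPowerSeries.coeff p.1 F * MvPowerSeries.coeff p.2 G‖
      ≤ ∑ p ∈ Finset.HasAntidiagonal.antidiagonal k, c * c' * b ^ k.degree := by
        refine norm_sum_le_of_le _ fun p hp => ?_
        rw [norm_mul, ← Finset.HasAntidiagonal.mem_antidiagonal.mp hp, map_add, pow_add]
        calc _ ≤ (c * b ^ p.1.degree) * (c' * b ^ p.2.degree) :=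
              mul_le_mul (hF _) (hG _) (norm_nonneg _) (by positivity)
          _ = _ := by ring
    _ = (Finset.HasAntidiagonal.antidiagonal k).card * (c * c' * b ^ k.degree) := by
        rw [Finset.sum_const, nsmul_eq_mul]
    _ ≤ (2 : ℝ) ^ k.degree * (c * c' * b ^ k.degree) := by
        gcongr; exact_mod_cast hcard
    _ = _ := by rw [mul_pow]; ring

end CoeffBound

/-! ### Values of series -/

lemma polydisk_eq_ball {n : ℕ} {r : ℝ} (hr : 0 < r) : polydisk n r = Metric.ball 0 r := by
  ext x
  rw [mem_ball_zero_iff, pi_norm_lt_iff hr]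
  rfl

lemma norm_monomial_le {n : ℕ} {x : Phase n} {r : ℝ} (hx : ∀ i, ‖x i‖ ≤ r) (k : Var n →₀ ℕ) :
    ‖k.prod fun i m => x i ^ m‖ ≤ r ^ k.degree := by
  rw [Finsupp.prod, norm_prod]
  calc ∏ i ∈ k.support, ‖x i ^ k i‖ ≤ ∏ i ∈ k.support, r ^ k i :=
        Finset.prod_le_prod (fun _ _ => norm_nonneg _) fun i _ => by
          rw [norm_pow]; exact pow_le_pow_left₀ (norm_nonneg _) (hx i) _
    _ = r ^ k.degree := by rw [Finset.prod_pow_eq_pow_sum]; rfl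

namespace CoeffBound

variable {n : ℕ} {c c' b r : ℝ} {F G : Series n} {x : Phase n}

lemma norm_term_le (h : CoeffBound c b F) (hb : 0 ≤ b) (hx : ∀ i, ‖x i‖ ≤ r)
    (k : Var n →₀ ℕ) : ‖term F x k‖ ≤ c * (b * r) ^ k.degree := by
  rw [term, norm_mul, mul_pow, ← mul_assoc]
  have := h.nonneg
  exact mul_le_mul (h k) (norm_monomial_le hx k) (norm_nonneg _) (by positivity)

lemma summable_norm_term (h : CoeffBound c b F) (hb : 0 ≤ b) (hr : 0 ≤ r) (hbr : b * r < 1)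
    (hx : ∀ i, ‖x i‖ ≤ r) : Summable fun k => ‖term F x k‖ :=
  ((summable_pow_degree (mul_nonneg hb hr) hbr).mul_left c).of_nonneg_of_le
    (fun _ => norm_nonneg _) (h.norm_term_le hb hx)

lemma summable_term (h : CoeffBound c b F) (hb : 0 ≤ b) (hr : 0 ≤ r) (hbr : b * r < 1)
    (hx : ∀ i, ‖x i‖ ≤ r) : Summable (term F x) :=
  (h.summable_norm_term hb hr hbr hx).of_norm

lemma norm_value_le (h : CoeffBound c b F) (hb : 0 ≤ b) (hr : 0 ≤ r) (hbr : b * r < 1)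
    (hx : ∀ i, ‖x i‖ ≤ r) : ‖value F x‖ ≤ c * geom n (b * r) := by
  rw [value, geom, ← tsum_mul_left]
  exact tsum_of_norm_bounded
    ((summable_pow_degree (mul_nonneg hb hr) hbr).mul_left c).hasSum (h.norm_term_le hb hx)

lemma value_add (hF : CoeffBound c b F) (hG : CoeffBound c' b G) (hb : 0 ≤ b) (hr : 0 ≤ r)
    (hbr : b * r < 1) (hx : ∀ i, ‖x i‖ ≤ r) : value (F + G) x = value F x + value G x := by
  rw [value, value, value, ← (hF.summable_term hb hr hbr hx).tsum_add
    (hG.summable_term hb hr hbr hx)]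
  exact tsum_congr fun k => by simp [term, add_mul]

lemma value_sum {ι : Type*} (s : Finset ι) {f : ι → Series n} {c : ι → ℝ}
    (h : ∀ i ∈ s, CoeffBound (c i) b (f i)) (hb : 0 ≤ b) (hr : 0 ≤ r)
    (hbr : b * r < 1) (hx : ∀ i, ‖x i‖ ≤ r) :
    value (∑ i ∈ s, f i) x = ∑ i ∈ s, value (f i) x := by
  simp only [value]
  rw [← Summable.tsum_finsetSum fun i hi => (h i hi).summable_term hb hr hbr hx]
  exact tsum_congr fun k => by simp [term, Finset.sum_mul]

lemma value_mul (hF : CoeffBound c b F) (hG : CoeffBound c' b G) (hb : 0 ≤ b) (hr : 0 ≤ r)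
    (hbr : b * r < 1) (hx : ∀ i, ‖x i‖ ≤ r) : value (F * G) x = value F x * value G x := by
  have hf := hF.summable_norm_term hb hr hbr hx
  have hg := hG.summable_norm_term hb hr hbr hx
  rw [value, value, value, hf.of_norm.tsum_mul_tsum_eq_tsum_sum_antidiagonal hg.of_norm
    (summable_mul_of_summable_norm hf hg)]
  refine tsum_congr fun k => ?_
  rw [term, MvPowerSeries.coeff_mul, Finset.sum_mul]
  refine Finset.sum_congr rfl fun p hp => ?_
  rw [← Finset.HasAntidiagonal.mem_antidiagonal.mp hp, Finsupp.prod_add_index' (fun _ => pow_zero _)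
    (fun _ _ _ => pow_add _ _ _), term, term]
  ring

end CoeffBound

lemma value_C_mul {n : ℕ} (a : ℂ) (F : Series n) (x : Phase n) :
    value (MvPowerSeries.C a * F) x = a * value F x := by
  rw [value, value, ← tsum_mul_left]
  exact tsum_congr fun k => by simp [term, mul_assoc]

lemma value_neg {n : ℕ} (F : Series n) (x : Phase n) : value (-F) x = -value F x := by
  rw [value, value, ← tsum_neg]
  exact tsum_congr fun k => by simp [term]

lemma value_zero {n : ℕ} (F : Series n) : value F 0 = MvPowerSeries.coeff 0 F := by
  rw [value, tsum_eq_single 0]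
  · simp [term]
  · intro k hk
    obtain ⟨i, hi⟩ := Finsupp.ne_iff.mp hk
    have : (k.prod fun i m => (0 : Phase n) i ^ m) = 0 :=
      Finset.prod_eq_zero (Finsupp.mem_support_iff.mpr hi) (by simpa using hi)
    rw [term, this, mul_zero]

/-- The derivative of the term with multi-index `k` in the variable `i`. -/
def termDeriv {n : ℕ} (F : Series n) (x : Phase n) (k : Var n →₀ ℕ) (i : Var n) : ℂ :=
  MvPowerSeries.coeff k F * ((k i : ℂ) * (k - Finsupp.single i 1).prod fun j m => x j ^ m)

/-- The truncated subtraction is harmless: when `k i = 0` its monomial is multiplied by zero. -/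
lemma hasFDerivAt_monomial {n : ℕ} (k : Var n →₀ ℕ) (x : Phase n) :
    HasFDerivAt (fun x : Phase n => k.prod fun i m => x i ^ m)
      (∑ i, ((k i : ℂ) * (k - Finsupp.single i 1).prod fun j m => x j ^ m) •
        (ContinuousLinearMap.proj i : Phase n →L[ℂ] ℂ)) x := by
  have h1 : ∀ (l : Var n →₀ ℕ) (x : Phase n), (l.prod fun i m => x i ^ m) = ∏ i, x i ^ l i :=
    fun l x => Finsupp.prod_fintype _ _ fun i => pow_zero _
  simp only [h1]
  have h2 := HasFDerivAt.finsetProd (u := (Finset.univ : Finset (Var n)))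
    (g := fun i (x : Phase n) => x i ^ k i) (x := x)
    (g' := fun i => ((k i : ℂ) * x i ^ (k i - 1)) • (ContinuousLinearMap.proj i : Phase n →L[ℂ] ℂ))
    fun i _ => by
      have := (ContinuousLinearMap.proj (R := ℂ) (φ := fun _ : Var n => ℂ) i).hasFDerivAt (x := x)
      simpa using this.pow (k i)
  refine h2.congr_fderiv (Eq.symm ?_)
  refine Finset.sum_congr rfl fun i _ => ?_
  rw [smul_smul, ← Finset.mul_prod_erase _ _ (Finset.mem_univ i)]
  congr 1
  have : ∏ j ∈ Finset.univ.erase i, x j ^ (k - Finsupp.single i 1 : Var n →₀ ℕ) j =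
      ∏ j ∈ Finset.univ.erase i, x j ^ k j := Finset.prod_congr rfl fun j hj => by
    simp [(Finset.ne_of_mem_erase hj).symm]
  rw [this]
  simp
  ring

/-- A shift of the summation index by `Finsupp.single i 1`; the terms it misses have `k i = 0` and
vanish. No convergence is required. -/
lemma value_pderiv {n : ℕ} (i : Var n) (F : Series n) (x : Phase n) :
    value (MvPowerSeries.pderiv ℂ i F) x = ∑' k, termDeriv F x k i := by
  have hinj : Function.Injective fun k : Var n →₀ ℕ => k + Finsupp.single i 1 :=
    add_left_injective _
  rw [← hinj.tsum_eq]
  · refine tsum_congr fun k => ?_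
    simp [term, termDeriv, MvPowerSeries.coeff_pderiv, mul_assoc]
  · intro k hk
    have : k i ≠ 0 := fun h => hk (by simp [termDeriv, h])
    exact ⟨k - Finsupp.single i 1, tsub_add_cancel_of_le (by
      rw [Finsupp.single_le_iff]; omega)⟩

lemma norm_monomial_deriv_le {n : ℕ} {x : Phase n} {r : ℝ} (hr : 0 < r) (hx : ∀ i, ‖x i‖ ≤ r)
    (k : Var n →₀ ℕ) (i : Var n) :
    ‖(k i : ℂ) * (k - Finsupp.single i 1).prod fun j m => x j ^ m‖ ≤ k i * r ^ k.degree / r := by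
  rw [norm_mul, Complex.norm_natCast]
  rcases Nat.eq_zero_or_pos (k i) with h | h
  · simp [h]
  · have h1 := norm_monomial_le hx (k - Finsupp.single i 1)
    have h2 : k - Finsupp.single i 1 + Finsupp.single i 1 = k :=
      tsub_add_cancel_of_le (by rw [Finsupp.single_le_iff]; omega)
    have h3 : r ^ k.degree = r ^ (k - Finsupp.single i 1).degree * r := by
      conv_lhs => rw [← h2, map_add, Finsupp.degree_single, pow_succ]
    rw [mul_div_assoc, h3, mul_div_cancel_right₀ _ hr.ne']
    gcongr

namespace CoeffBound

variable {n : ℕ} {c c' b r : ℝ} {F G : Series n} {x : Phase n}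

/-- Summing over the variables turns the factors `k i` into `|k| ≤ 2 ^ |k|`. This is the summable
majorant for termwise differentiation. -/
lemma norm_term_deriv_le (h : CoeffBound c b F) (hb : 0 ≤ b) (hr : 0 < r)
    (hx : ∀ i, ‖x i‖ ≤ r) (k : Var n →₀ ℕ) :
    ∑ i, ‖termDeriv F x k i‖ ≤ c / r * (2 * b * r) ^ k.degree := by
  have hc := h.nonneg
  calc _ ≤ ∑ i, (c * b ^ k.degree) * (k i * r ^ k.degree / r) :=
        Finset.sum_le_sum fun i _ => by
          rw [termDeriv, norm_mul]
          exact mul_le_mul (h k) (norm_monomial_deriv_le hr hx k i) (norm_nonneg _) (by positivity)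
    _ = c / r * (k.degree * b ^ k.degree * r ^ k.degree) := by
        rw [Finsupp.degree_eq_sum]; push_cast
        rw [← Finset.mul_sum, ← Finset.sum_div, ← Finset.sum_mul]; ring
    _ ≤ c / r * (2 ^ k.degree * b ^ k.degree * r ^ k.degree) := by
        gcongr
        exact_mod_cast (Nat.lt_two_pow_self (n := k.degree)).le
    _ = _ := by rw [mul_pow, mul_pow]

lemma hasFDerivAt_term (F : Series n) (x : Phase n) (k : Var n →₀ ℕ) :
    HasFDerivAt (fun y => term F y k) (∑ i, termDeriv F x k i •
        (ContinuousLinearMap.proj i : Phase n →L[ℂ] ℂ)) x := by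
  refine ((hasFDerivAt_monomial k x).const_mul (MvPowerSeries.coeff k F)).congr_fderiv ?_
  rw [Finset.smul_sum]
  simp only [smul_smul, termDeriv]

lemma norm_sum_smul_proj_le (a : Var n → ℂ) :
    ‖∑ i, a i • (ContinuousLinearMap.proj i : Phase n →L[ℂ] ℂ)‖ ≤ ∑ i, ‖a i‖ := by
  refine norm_sum_le_of_le _ fun i _ => ?_
  rw [norm_smul]
  refine mul_le_of_le_one_right (norm_nonneg _) (ContinuousLinearMap.opNorm_le_bound _ zero_le_one
    fun y => ?_)
  rw [one_mul]
  exact norm_le_pi_norm y i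

lemma tsum_term_deriv (h : CoeffBound c b F) (hb : 0 ≤ b) (hr : 0 < r) (hbr : 2 * b * r < 1)
    (hx : ∀ i, ‖x i‖ ≤ r) :
    ∑' k, ∑ i, termDeriv F x k i •
        (ContinuousLinearMap.proj i : Phase n →L[ℂ] ℂ) =
    ∑ i, value (MvPowerSeries.pderiv ℂ i F) x •
      (ContinuousLinearMap.proj i : Phase n →L[ℂ] ℂ) := by
  have hs : ∀ i, Summable fun k => termDeriv F x k i := fun i =>
    Summable.of_norm_bounded ((summable_pow_degree (by positivity) hbr).mul_left (c / r))
      fun k => (Finset.single_le_sum (f := fun i => ‖termDeriv F x k i‖)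
        (fun _ _ => norm_nonneg _) (Finset.mem_univ i)).trans (h.norm_term_deriv_le hb hr hx k)
  rw [Summable.tsum_finsetSum fun i _ => (hs i).smul_const _]
  refine Finset.sum_congr rfl fun i _ => ?_
  rw [(hs i).tsum_smul_const, value_pderiv]

lemma hasFDerivAt_value (h : CoeffBound c b F) (hb : 0 ≤ b) (hr : 0 < r) (hbr : 2 * b * r < 1)
    (hx : x ∈ Metric.ball (0 : Phase n) r) :
    HasFDerivAt (value F) (∑ i, value (MvPowerSeries.pderiv ℂ i F) x •
      (ContinuousLinearMap.proj i : Phase n →L[ℂ] ℂ)) x := by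
  have hle : ∀ y ∈ Metric.ball (0 : Phase n) r, ∀ i, ‖y i‖ ≤ r := fun y hy i =>
    (norm_le_pi_norm y i).trans (mem_ball_zero_iff.mp hy).le
  rw [← h.tsum_term_deriv hb hr hbr (hle x hx)]
  have hbr' : b * r < 1 := by nlinarith [mul_nonneg hb hr.le]
  exact hasFDerivAt_tsum_of_isPreconnected
    ((summable_pow_degree (by positivity) hbr).mul_left (c / r)) Metric.isOpen_ball
    (convex_ball 0 r).isPreconnected (fun k y _ => hasFDerivAt_term F y k)
    (fun k y hy => (norm_sum_smul_proj_le _).trans (h.norm_term_deriv_le hb hr (hle y hy) k))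
    hx (h.summable_term hb hr.le hbr' (hle x hx)) hx

lemma norm_value_sub_le (h : CoeffBound c b F) (hb : 0 ≤ b) (hr : 0 < r) (hbr : 2 * b * r < 1)
    {y : Phase n} (hx : x ∈ Metric.ball (0 : Phase n) r) (hy : y ∈ Metric.ball (0 : Phase n) r) :
    ‖value F x - value F y‖ ≤ (2 * n * (c * b * geom n (2 * b * r))) * ‖x - y‖ := by
  refine (convex_ball 0 r).norm_image_sub_le_of_norm_hasFDerivWithin_le (𝕜 := ℂ)
    (fun z hz => (h.hasFDerivAt_value hb hr hbr hz).hasFDerivWithinAt) (fun z hz => ?_) hy hx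
  refine (norm_sum_smul_proj_le _).trans ?_
  have := Finset.sum_le_card_nsmul (Finset.univ : Finset (Var n))
    (fun i => ‖value (MvPowerSeries.pderiv ℂ i F) z‖) (c * b * geom n (2 * b * r)) fun i _ =>
      (h.pderiv hb i).norm_value_le (by positivity) hr.le hbr fun j =>
        (norm_le_pi_norm z j).trans (mem_ball_zero_iff.mp hz).le
  refine this.trans (le_of_eq ?_)
  rw [nsmul_eq_mul]
  simp [two_mul]

end CoeffBound

lemma continuousOn_value_of_coeffBound {n : ℕ} {c b r : ℝ} {x : Phase n} {S : Set ℝ}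
    {Φ : ℝ → Series n} (hΦ : ∀ s ∈ S, CoeffBound c b (Φ s))
    (hc : ∀ k, ContinuousOn (fun s => MvPowerSeries.coeff k (Φ s)) S)
    (hb : 0 ≤ b) (hr : 0 ≤ r) (hbr : b * r < 1) (hx : ∀ i, ‖x i‖ ≤ r) :
    ContinuousOn (fun s => value (Φ s) x) S :=
  continuousOn_tsum (fun k => (hc k).mul continuousOn_const)
    ((summable_pow_degree (mul_nonneg hb hr) hbr).mul_left c)
    fun k s hs => (hΦ s hs).norm_term_le hb hx k

/-! ### Harmonics and the Poisson bracket -/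

section Formal

variable {n : ℕ} {F G H N P P' : Series n}

@[simp] lemma coeff_harmonic (q : Fin n → ℤ) (H : Series n) (k : Var n →₀ ℕ) :
    MvPowerSeries.coeff k (harmonic q H) =
      if harmonicIndex k = q then MvPowerSeries.coeff k H else 0 := rfl

lemma coeff_xi (ω : Fin n → ℝ) (H : Series n) (k : Var n →₀ ℕ) :
    MvPowerSeries.coeff k (xi ω H) =
      -Complex.I * ((Real.sign (pairing ω (harmonicIndex k)) : ℝ) : ℂ) *
        MvPowerSeries.coeff k H := rfl

lemma harmonicIndex_add (a b : Var n →₀ ℕ) :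
    harmonicIndex (a + b) = harmonicIndex a + harmonicIndex b := by
  funext j
  simp only [harmonicIndex, Finsupp.add_apply, Pi.add_apply]
  push_cast
  ring

lemma pairing_zero (ω : Fin n → ℝ) : pairing ω 0 = 0 := by simp [pairing]

lemma coeff_eq_zero_of_notMem_support {k : Var n →₀ ℕ} (h : harmonicIndex k ∉ support H) :
    MvPowerSeries.coeff k H = 0 := by
  have h' : harmonic (harmonicIndex k) H = 0 := not_not.mp h
  simpa using congrArg (MvPowerSeries.coeff k) h'

/-- All terms of `P` have harmonic index `0`. -/
def Resonant (P : Series n) : Prop := ∀ k, harmonicIndex k ≠ 0 → MvPowerSeries.coeff k P = 0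

lemma resonant_harmonic_zero (H : Series n) : Resonant (harmonic 0 H) := fun k hk => by
  simp [hk]

namespace Resonant

lemma harmonicIndex_snd (h : Resonant P) {k : Var n →₀ ℕ} {p : (Var n →₀ ℕ) × (Var n →₀ ℕ)}
    (hp : p.1 + p.2 = k) (h1 : MvPowerSeries.coeff p.1 P ≠ 0) :
    harmonicIndex p.2 = harmonicIndex k := by
  rw [← hp, harmonicIndex_add, not_not.mp fun h' => h1 (h _ h'), zero_add]

/-- Harmonic indices add under multiplication and those of `P` are zero, so multiplication by `P`
maps each harmonic into itself; only the harmonic of `k` is seen by the coefficient at `k`. -/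
lemma coeff_mul_congr (h : Resonant P) {k : Var n →₀ ℕ} {a : ℂ}
    (hFG : ∀ l, harmonicIndex l = harmonicIndex k →
      MvPowerSeries.coeff l F = a * MvPowerSeries.coeff l G) :
    MvPowerSeries.coeff k (P * F) = a * MvPowerSeries.coeff k (P * G) := by
  rw [MvPowerSeries.coeff_mul, MvPowerSeries.coeff_mul, Finset.mul_sum]
  refine Finset.sum_congr rfl fun p hp => ?_
  by_cases h1 : MvPowerSeries.coeff p.1 P = 0
  · simp [h1]
  · rw [hFG _ (h.harmonicIndex_snd (Finset.HasAntidiagonal.mem_antidiagonal.mp hp) h1)]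
    ring

lemma coeff_mul_eq_zero (h : Resonant P) {k : Var n →₀ ℕ}
    (hF : ∀ l, harmonicIndex l = harmonicIndex k → MvPowerSeries.coeff l F = 0) :
    MvPowerSeries.coeff k (P * F) = 0 := by
  rw [h.coeff_mul_congr (a := 0) (G := 0) (by simpa using hF), zero_mul]

lemma mul (h : Resonant P) (h' : Resonant P') : Resonant (P * P') := fun _ hk =>
  h.coeff_mul_eq_zero fun l hl => h' l (hl ▸ hk)

lemma one : Resonant (1 : Series n) := fun _ hk => by
  classical
  rw [MvPowerSeries.coeff_one, if_neg]
  rintro rfl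
  exact hk (by funext j; simp [harmonicIndex])

lemma pow (h : Resonant P) (m : ℕ) : Resonant (P ^ m) := by
  induction m with
  | zero => rw [pow_zero]; exact one
  | succ m ih => rw [pow_succ]; exact ih.mul h

end Resonant

/-- The derivative of `N` in the action `z_j z̄_j`, for a series `N` in the actions. -/
def actionGrad (N : Series n) (j : Fin n) : Series n := fun k =>
  ((k (Sum.inl j) : ℂ) + 1) *
    MvPowerSeries.coeff (k + Finsupp.single (Sum.inl j) 1 + Finsupp.single (Sum.inr j) 1) N

lemma coeff_actionGrad (N : Series n) (j : Fin n) (k : Var n →₀ ℕ) :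
    MvPowerSeries.coeff k (actionGrad N j) = ((k (Sum.inl j) : ℂ) + 1) *
      MvPowerSeries.coeff
        (k + Finsupp.single (Sum.inl j) 1 + Finsupp.single (Sum.inr j) 1) N := rfl

/-- The frequency `⟨q, ∂N⟩` of the harmonic `q` in the normal form `N`. -/
def freqSeries (N : Series n) (q : Fin n → ℤ) : Series n :=
  ∑ j, MvPowerSeries.C (q j : ℂ) * actionGrad N j

lemma harmonicIndex_add_pair (k : Var n →₀ ℕ) (j : Fin n) :
    harmonicIndex (k + Finsupp.single (Sum.inl j) 1 + Finsupp.single (Sum.inr j) 1) =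
      harmonicIndex k := by
  rw [add_assoc, harmonicIndex_add, add_eq_left]
  funext i
  simp [harmonicIndex, Finsupp.single_apply]

lemma Resonant.actionGrad (h : Resonant N) (j : Fin n) : Resonant (actionGrad N j) := fun k hk => by
  rw [coeff_actionGrad, h _ (by rwa [harmonicIndex_add_pair]), mul_zero]

lemma Resonant.freqSeries (h : Resonant N) (q : Fin n → ℤ) : Resonant (freqSeries N q) :=
  fun k hk => by
    rw [NormalizationFlow.freqSeries, map_sum]
    refine Finset.sum_eq_zero fun j _ => ?_
    rw [MvPowerSeries.coeff_C_mul, h.actionGrad j k hk, mul_zero]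

lemma freqSeries_zero (N : Series n) : freqSeries N 0 = 0 := by simp [freqSeries]

lemma coeff_zero_freqSeries (hN : N ∈ Cubic n) (q : Fin n → ℤ) :
    MvPowerSeries.coeff 0 (freqSeries N q) = 0 := by
  rw [freqSeries, map_sum]
  refine Finset.sum_eq_zero fun j _ => ?_
  rw [MvPowerSeries.coeff_C_mul, coeff_actionGrad, hN _ (by simp [map_add, Finsupp.degree_single]),
    mul_zero, mul_zero]

lemma coeff_add_single_X_mul (i : Var n) (F : Series n) (k : Var n →₀ ℕ) :
    MvPowerSeries.coeff (k + Finsupp.single i 1) (MvPowerSeries.X i * F) =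
      MvPowerSeries.coeff k F := by
  rw [add_comm, MvPowerSeries.X, MvPowerSeries.coeff_add_monomial_mul, one_mul]

lemma coeff_X_mul_of_eq_zero (i : Var n) (F : Series n) {k : Var n →₀ ℕ} (hk : k i = 0) :
    MvPowerSeries.coeff k (MvPowerSeries.X i * F) = 0 := by
  classical
  rw [MvPowerSeries.X, MvPowerSeries.coeff_monomial_mul, if_neg]
  rw [Finsupp.single_le_iff]
  omega

lemma exists_eq_add_single {k : Var n →₀ ℕ} {i : Var n} (hk : k i ≠ 0) :
    ∃ l, k = l + Finsupp.single i 1 :=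
  ⟨k - Finsupp.single i 1, (tsub_add_cancel_of_le (by rw [Finsupp.single_le_iff]; omega)).symm⟩

lemma coeff_X_mul_pderiv (i : Var n) (F : Series n) (k : Var n →₀ ℕ) :
    MvPowerSeries.coeff k (MvPowerSeries.X i * MvPowerSeries.pderiv ℂ i F) =
      k i * MvPowerSeries.coeff k F := by
  by_cases hk : k i = 0
  · rw [coeff_X_mul_of_eq_zero i _ hk, hk, Nat.cast_zero, zero_mul]
  · obtain ⟨l, rfl⟩ := exists_eq_add_single hk
    rw [coeff_add_single_X_mul, MvPowerSeries.coeff_pderiv]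
    simp [mul_comm]

/-- The chain rule for a function of the actions `z_j z̄_j`. If `z̄_j` is absent from the monomial,
its coefficient comes from a nonresonant index and is zero. -/
lemma Resonant.pderiv_inl (h : Resonant N) (j : Fin n) :
    MvPowerSeries.pderiv ℂ (Sum.inl j) N =
      MvPowerSeries.X (Sum.inr j) * NormalizationFlow.actionGrad N j := by
  ext k
  by_cases hk : k (Sum.inr j) = 0
  · rw [coeff_X_mul_of_eq_zero _ _ hk, MvPowerSeries.coeff_pderiv, h, zero_mul]
    intro h0
    have := congrFun h0 j
    simp [harmonicIndex, hk] at this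
    omega
  · obtain ⟨l, rfl⟩ := exists_eq_add_single hk
    rw [coeff_add_single_X_mul, MvPowerSeries.coeff_pderiv, coeff_actionGrad, add_right_comm]
    simp [mul_comm]

lemma Resonant.pderiv_inr (h : Resonant N) (j : Fin n) :
    MvPowerSeries.pderiv ℂ (Sum.inr j) N =
      MvPowerSeries.X (Sum.inl j) * NormalizationFlow.actionGrad N j := by
  ext k
  by_cases hk : k (Sum.inl j) = 0
  · rw [coeff_X_mul_of_eq_zero _ _ hk, MvPowerSeries.coeff_pderiv, h, zero_mul]
    intro h0
    have := congrFun h0 j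
    simp [harmonicIndex, hk] at this
    omega
  · obtain ⟨l, rfl⟩ := exists_eq_add_single hk
    rw [coeff_add_single_X_mul, MvPowerSeries.coeff_pderiv, coeff_actionGrad, mul_comm]
    -- `actionGrad` is defined by the exponent of `z_j`, the derivative produces that of `z̄_j`;
    -- they agree exactly because resonant monomials contain both equally.
    by_cases h0 : harmonicIndex l = 0
    · have := congrFun h0 j
      simp only [harmonicIndex, Pi.zero_apply, sub_eq_zero] at this
      have h1 : l (Sum.inr j) = l (Sum.inl j) := by exact_mod_cast this
      simp [h1]
    · rw [h _ (by rwa [harmonicIndex_add_pair]), mul_zero, mul_zero]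

/-! ### Algebra of the bracket; brackets with resonant series and with `H₂` -/

lemma poisson_add_right (F G G' : Series n) :
    poisson F (G + G') = poisson F G + poisson F G' := by
  simp only [poisson, map_add, ← mul_add, ← Finset.sum_add_distrib]
  congr 1
  exact Finset.sum_congr rfl fun j _ => by ring

lemma poisson_self (F : Series n) : poisson F F = 0 := by
  rw [poisson, Finset.sum_eq_zero fun j _ => ?_, mul_zero]
  ring

lemma pderiv_C_mul (i : Var n) (a : ℂ) (F : Series n) :
    MvPowerSeries.pderiv ℂ i (MvPowerSeries.C a * F) =
      MvPowerSeries.C a * MvPowerSeries.pderiv ℂ i F := by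
  rw [← MvPowerSeries.smul_eq_C_mul, ← MvPowerSeries.smul_eq_C_mul, Derivation.map_smul]

lemma poisson_C_mul_left (a : ℂ) (F G : Series n) :
    poisson (MvPowerSeries.C a * F) G = MvPowerSeries.C a * poisson F G := by
  simp only [poisson, pderiv_C_mul]
  rw [mul_left_comm, Finset.mul_sum (a := MvPowerSeries.C a)]
  congr 1
  exact Finset.sum_congr rfl fun j _ => by ring

/-- By the chain rule `{F, N} = i ∑ ∂_j N (z̄_j ∂_{z̄_j} - z_j ∂_{z_j}) F`. The Euler operator
multiplies a coefficient by the `j`-th entry of its harmonic index, which the resonant factor `∂_j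
N` does not change. -/
lemma Resonant.coeff_poisson (h : Resonant N) (F : Series n) (k : Var n →₀ ℕ) :
    MvPowerSeries.coeff k (poisson F N) =
      Complex.I * MvPowerSeries.coeff k
        (NormalizationFlow.freqSeries N (harmonicIndex k) * F) := by
  have h1 : poisson F N = MvPowerSeries.C Complex.I * ∑ j, NormalizationFlow.actionGrad N j *
      (MvPowerSeries.X (Sum.inr j) * MvPowerSeries.pderiv ℂ (Sum.inr j) F -
        MvPowerSeries.X (Sum.inl j) * MvPowerSeries.pderiv ℂ (Sum.inl j) F) := by
    rw [poisson]
    congr 1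
    refine Finset.sum_congr rfl fun j _ => ?_
    rw [h.pderiv_inl, h.pderiv_inr]
    ring
  rw [h1, MvPowerSeries.coeff_C_mul, map_sum, NormalizationFlow.freqSeries, Finset.sum_mul, map_sum]
  congr 1
  refine Finset.sum_congr rfl fun j _ => ?_
  rw [mul_assoc, MvPowerSeries.coeff_C_mul]
  refine (h.actionGrad j).coeff_mul_congr fun l hl => ?_
  rw [map_sub, coeff_X_mul_pderiv, coeff_X_mul_pderiv, ← hl, harmonicIndex]
  push_cast
  ring

lemma pderiv_inl_quadratic (ω : Fin n → ℝ) (j : Fin n) :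
    MvPowerSeries.pderiv ℂ (Sum.inl j) (quadratic ω) =
      MvPowerSeries.C (ω j : ℂ) * MvPowerSeries.X (Sum.inr j) := by
  classical
  simp [quadratic, Derivation.leibniz, MvPowerSeries.pderiv_X, Pi.single_apply, mul_comm]

lemma pderiv_inr_quadratic (ω : Fin n → ℝ) (j : Fin n) :
    MvPowerSeries.pderiv ℂ (Sum.inr j) (quadratic ω) =
      MvPowerSeries.C (ω j : ℂ) * MvPowerSeries.X (Sum.inl j) := by
  classical
  simp [quadratic, Derivation.leibniz, MvPowerSeries.pderiv_X, Pi.single_apply, mul_comm]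

lemma coeff_poisson_quadratic (ω : Fin n → ℝ) (F : Series n) (k : Var n →₀ ℕ) :
    MvPowerSeries.coeff k (poisson F (quadratic ω)) =
      Complex.I * pairing ω (harmonicIndex k) * MvPowerSeries.coeff k F := by
  have h1 : poisson F (quadratic ω) = MvPowerSeries.C Complex.I * ∑ j, MvPowerSeries.C (ω j : ℂ) *
      (MvPowerSeries.X (Sum.inr j) * MvPowerSeries.pderiv ℂ (Sum.inr j) F -
        MvPowerSeries.X (Sum.inl j) * MvPowerSeries.pderiv ℂ (Sum.inl j) F) := by
    rw [poisson]
    congr 1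
    refine Finset.sum_congr rfl fun j _ => ?_
    rw [pderiv_inl_quadratic, pderiv_inr_quadratic]
    ring
  rw [h1, MvPowerSeries.coeff_C_mul, map_sum, pairing, mul_assoc]
  push_cast
  rw [Finset.sum_mul]
  congr 1
  refine Finset.sum_congr rfl fun j _ => ?_
  rw [MvPowerSeries.coeff_C_mul, map_sub, coeff_X_mul_pderiv, coeff_X_mul_pderiv, harmonicIndex]
  push_cast
  ring

/-! ### The exponential of a formal series without constant term -/

/-- The exponential `exp (-δ P)` of a series `P` without constant term. -/
def expSeries (P : Series n) (δ : ℝ) : Series n := fun k =>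
  ∑ m ∈ Finset.range (k.degree + 1), (-δ : ℂ) ^ m / m.factorial * MvPowerSeries.coeff k (P ^ m)

/-- This is why the finite sum in `expSeries` is the whole exponential series. -/
lemma coeff_pow_eq_zero (hP : MvPowerSeries.coeff 0 P = 0) {m : ℕ} :
    ∀ {k : Var n →₀ ℕ}, k.degree < m → MvPowerSeries.coeff k (P ^ m) = 0 := by
  induction m with
  | zero => intro k hk; omega
  | succ m ih =>
    intro k hk
    rw [pow_succ, MvPowerSeries.coeff_mul]
    refine Finset.sum_eq_zero fun p hp => ?_
    have hp' : p.1.degree + p.2.degree = k.degree := by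
      rw [← map_add, Finset.HasAntidiagonal.mem_antidiagonal.mp hp]
    by_cases h2 : p.2 = 0
    · rw [h2, hP, mul_zero]
    · have : p.2.degree ≠ 0 := fun h => h2 ((Finsupp.degree_eq_zero_iff _).mp h)
      rw [ih (by omega), zero_mul]

/-- A truncation order common to several coefficients is needed to handle products and derivatives.
-/
lemma coeff_expSeries (hP : MvPowerSeries.coeff 0 P = 0) (δ : ℝ) {k : Var n →₀ ℕ} {M : ℕ}
    (hM : k.degree < M) : MvPowerSeries.coeff k (expSeries P δ) =
      ∑ m ∈ Finset.range M, (-δ : ℂ) ^ m / m.factorial * MvPowerSeries.coeff k (P ^ m) := by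
  change ∑ m ∈ Finset.range (k.degree + 1), _ = _
  refine Finset.sum_subset (Finset.range_mono hM) fun m _ hm => ?_
  rw [coeff_pow_eq_zero hP (by simpa using hm), mul_zero]

lemma expSeries_time_zero (P : Series n) : expSeries P 0 = 1 := by
  ext k
  change ∑ m ∈ Finset.range (k.degree + 1), _ = _
  rw [Finset.sum_range_succ', Finset.sum_eq_zero fun m _ => by simp]
  simp

lemma expSeries_zero (δ : ℝ) : expSeries (0 : Series n) δ = 1 := by
  ext k
  change ∑ m ∈ Finset.range (k.degree + 1), _ = _
  rw [Finset.sum_range_succ', Finset.sum_eq_zero fun m _ => by simp]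
  simp

lemma Resonant.expSeries (h : Resonant P) (δ : ℝ) : Resonant (expSeries P δ) := fun k hk => by
  change ∑ m ∈ Finset.range (k.degree + 1), _ = _
  exact Finset.sum_eq_zero fun m _ => by rw [h.pow m k hk, mul_zero]

lemma coeff_mul_expSeries (hP : MvPowerSeries.coeff 0 P = 0) (δ : ℝ) (k : Var n →₀ ℕ) :
    MvPowerSeries.coeff k (P * expSeries P δ) = ∑ m ∈ Finset.range (k.degree + 1),
      (-δ : ℂ) ^ m / m.factorial * MvPowerSeries.coeff k (P ^ (m + 1)) := by
  simp only [pow_succ', MvPowerSeries.coeff_mul k P, Finset.mul_sum]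
  rw [Finset.sum_comm]
  refine Finset.sum_congr rfl fun p hp => ?_
  have hp' : p.1.degree + p.2.degree = k.degree := by
    rw [← map_add, Finset.HasAntidiagonal.mem_antidiagonal.mp hp]
  rw [coeff_expSeries hP δ (show p.2.degree < k.degree + 1 by omega), Finset.mul_sum]
  exact Finset.sum_congr rfl fun m _ => by ring

lemma hasDerivAt_coeff_expSeries (hP : MvPowerSeries.coeff 0 P = 0) (k : Var n →₀ ℕ) (δ : ℝ) :
    HasDerivAt (fun s => MvPowerSeries.coeff k (expSeries P s))
      (-MvPowerSeries.coeff k (P * expSeries P δ)) δ := by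
  have h1 : (fun s => MvPowerSeries.coeff k (expSeries P s)) = fun s : ℝ =>
      (∑ m ∈ Finset.range (k.degree + 1), (-s : ℂ) ^ (m + 1) / (m + 1).factorial *
        MvPowerSeries.coeff k (P ^ (m + 1))) + MvPowerSeries.coeff k (P ^ 0) := by
    funext s
    -- One order more than necessary is kept: after the constant summand `m = 0` is split off, the
    -- range matches that of `coeff_mul_expSeries`.
    rw [coeff_expSeries hP s (show k.degree < k.degree + 1 + 1 by omega), Finset.sum_range_succ']
    simp
  rw [h1, coeff_mul_expSeries hP, ← Finset.sum_neg_distrib]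
  refine HasDerivAt.add_const _ (HasDerivAt.fun_sum fun m _ => ?_)
  have h2 : HasDerivAt (fun s : ℝ => (-s : ℂ)) (-1) δ := (Complex.ofRealCLM.hasDerivAt).neg
  refine (((h2.pow (m + 1)).div_const ((m + 1).factorial : ℂ)).mul_const
    (MvPowerSeries.coeff k (P ^ (m + 1)))).congr_deriv ?_
  have : (m.factorial : ℂ) ≠ 0 := by exact_mod_cast m.factorial_ne_zero
  have : (m : ℂ) + 1 ≠ 0 := by exact_mod_cast m.succ_ne_zero
  rw [Nat.factorial_succ]
  push_cast
  field_simp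

lemma hasDerivAt_coeff_expSeries_mul (hP : MvPowerSeries.coeff 0 P = 0) (H : Series n)
    (k : Var n →₀ ℕ) (δ : ℝ) :
    HasDerivAt (fun s => MvPowerSeries.coeff k (expSeries P s * H))
      (-MvPowerSeries.coeff k (P * (expSeries P δ * H))) δ := by
  rw [← mul_assoc]
  simp only [MvPowerSeries.coeff_mul k _ H]
  rw [← Finset.sum_neg_distrib]
  refine HasDerivAt.fun_sum fun p _ => ?_
  rw [← neg_mul]
  exact (hasDerivAt_coeff_expSeries hP p.1 δ).mul_const _

end Formal

section Orbit

variable {n : ℕ} {ω : Fin n → ℝ} {H : Series n}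

/-! ### The orbit of the normalization flow -/

lemma harmonic_mem_cubic (hH : H ∈ Cubic n) (q : Fin n → ℤ) : harmonic q H ∈ Cubic n :=
  fun k hk => by rw [coeff_harmonic, hH k hk, ite_self]

/-- The frequency series of the normal form of `H`. -/
def normalFreq (H : Series n) (q : Fin n → ℤ) : Series n := freqSeries (harmonic 0 H) q

lemma resonant_normalFreq (H : Series n) (q : Fin n → ℤ) : Resonant (normalFreq H q) :=
  (resonant_harmonic_zero H).freqSeries q

lemma coeff_zero_normalFreq (hH : H ∈ Cubic n) (q : Fin n → ℤ) :
    MvPowerSeries.coeff 0 (normalFreq H q) = 0 :=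
  coeff_zero_freqSeries (harmonic_mem_cubic hH 0) q

/-- The explicit orbit: the harmonic `q` is multiplied by `exp (-δ (⟨ω, q⟩ + ⟨q, ∂N⟩))`, where
`N` is the normal form. -/
def orbit (ω : Fin n → ℝ) (H : Series n) (δ : ℝ) : Series n := fun k =>
  Complex.exp (-(pairing ω (harmonicIndex k) : ℂ) * δ) *
    MvPowerSeries.coeff k (expSeries (normalFreq H (harmonicIndex k)) δ * H)

lemma coeff_orbit (ω : Fin n → ℝ) (H : Series n) (δ : ℝ) (k : Var n →₀ ℕ) :
    MvPowerSeries.coeff k (orbit ω H δ) =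
      Complex.exp (-(pairing ω (harmonicIndex k) : ℂ) * δ) *
        MvPowerSeries.coeff k (expSeries (normalFreq H (harmonicIndex k)) δ * H) := rfl

lemma orbit_zero (ω : Fin n → ℝ) (H : Series n) : orbit ω H 0 = H := by
  ext k
  rw [coeff_orbit, expSeries_time_zero]
  simp

lemma orbit_mem_cubic (hH : H ∈ Cubic n) (δ : ℝ) : orbit ω H δ ∈ Cubic n := fun k hk => by
  rw [coeff_orbit, MvPowerSeries.coeff_mul, Finset.sum_eq_zero fun p hp => ?_, mul_zero]
  have hp' : p.1.degree + p.2.degree = k.degree := by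
    rw [← map_add, Finset.HasAntidiagonal.mem_antidiagonal.mp hp]
  rw [hH p.2 (by omega), mul_zero]

/-- The exponential is resonant, so it creates no new harmonics; the half-space condition therefore
persists along the orbit. -/
lemma coeff_orbit_of_notMem {k : Var n →₀ ℕ} (hk : harmonicIndex k ∉ support H) (δ : ℝ) :
    MvPowerSeries.coeff k (orbit ω H δ) = 0 := by
  rw [coeff_orbit, ((resonant_normalFreq H _).expSeries δ).coeff_mul_eq_zero, mul_zero]
  exact fun l hl => coeff_eq_zero_of_notMem_support (hl ▸ hk)

lemma coeff_orbit_of_harmonicIndex_eq_zero {k : Var n →₀ ℕ} (hk : harmonicIndex k = 0) (δ : ℝ) :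
    MvPowerSeries.coeff k (orbit ω H δ) = MvPowerSeries.coeff k H := by
  rw [coeff_orbit, hk, normalFreq, freqSeries_zero, expSeries_zero, one_mul, pairing_zero]
  simp

/-- The sign is `1` on every nonzero harmonic that is present and `0` on the zero harmonic, which
does not move. This is where the flow becomes linear. -/
lemma xi_orbit (hω : Nonresonant ω) (hS : ∀ q ∈ support H, 0 ≤ pairing ω q) (δ : ℝ) :
    xi ω (orbit ω H δ) = MvPowerSeries.C (-Complex.I) * (orbit ω H δ - harmonic 0 H) := by
  ext k
  rw [coeff_xi, MvPowerSeries.coeff_C_mul, map_sub, coeff_harmonic]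
  split_ifs with hk
  · rw [coeff_orbit_of_harmonicIndex_eq_zero hk, hk, pairing_zero]
    simp
  · by_cases hs : harmonicIndex k ∈ support H
    · rw [Real.sign_of_pos (lt_of_le_of_ne (hS _ hs) (hω _ hk).symm)]
      simp
    · rw [coeff_orbit_of_notMem hs]
      simp

lemma hasDerivAt_coeff_orbit (hH : H ∈ Cubic n) (k : Var n →₀ ℕ) (δ : ℝ) :
    HasDerivAt (fun s => MvPowerSeries.coeff k (orbit ω H s))
      (-(pairing ω (harmonicIndex k) : ℂ) * MvPowerSeries.coeff k (orbit ω H δ) -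
        MvPowerSeries.coeff k (normalFreq H (harmonicIndex k) * orbit ω H δ)) δ := by
  have h1 : HasDerivAt (fun s : ℝ => Complex.exp (-(pairing ω (harmonicIndex k) : ℂ) * s))
      (Complex.exp (-(pairing ω (harmonicIndex k) : ℂ) * δ) *
        (-(pairing ω (harmonicIndex k) : ℂ) * 1)) δ :=
    ((Complex.ofRealCLM.hasDerivAt).const_mul _).cexp
  have h2 := hasDerivAt_coeff_expSeries_mul
    (coeff_zero_normalFreq hH (harmonicIndex k)) H k δ
  refine (h1.mul h2).congr_deriv ?_
  -- On the single harmonic seen by this product the orbit is one scalar times `expSeries _ δ * H`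
  -- with the same `q`.
  rw [(resonant_normalFreq H _).coeff_mul_congr
    (a := Complex.exp (-(pairing ω (harmonicIndex k) : ℂ) * δ))
    (F := orbit ω H δ) (G := expSeries (normalFreq H (harmonicIndex k)) δ * H)
    fun l hl => by rw [coeff_orbit, hl], coeff_orbit]
  ring

/-- With `G = H(δ) - N`, antisymmetry removes `{G, G}`, and the brackets with `H₂` and `N` are
diagonal in the harmonics. Replacing `G` by the orbit changes nothing, since the contributions of
`N` itself vanish (`h2`, `h3`). -/
lemma coeff_neg_poisson_orbit (hω : Nonresonant ω) (hS : ∀ q ∈ support H, 0 ≤ pairing ω q)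
    (δ : ℝ) (k : Var n →₀ ℕ) :
    MvPowerSeries.coeff k (-poisson (xi ω (orbit ω H δ)) (quadratic ω + orbit ω H δ)) =
      -(pairing ω (harmonicIndex k) : ℂ) * MvPowerSeries.coeff k (orbit ω H δ) -
        MvPowerSeries.coeff k (normalFreq H (harmonicIndex k) * orbit ω H δ) := by
  have hN := resonant_harmonic_zero H
  set G := orbit ω H δ - harmonic 0 H with hG
  have h1 : poisson G (quadratic ω + orbit ω H δ) =
      poisson G (quadratic ω) + poisson G (harmonic 0 H) := by
    rw [show orbit ω H δ = G + harmonic 0 H by rw [hG, sub_add_cancel], poisson_add_right,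
      poisson_add_right, poisson_self, zero_add]
  have h2 : MvPowerSeries.coeff k (normalFreq H (harmonicIndex k) * harmonic 0 H) = 0 := by
    by_cases hk : harmonicIndex k = 0
    · rw [hk, normalFreq, freqSeries_zero, zero_mul, map_zero]
    · exact (resonant_normalFreq H _).mul hN k hk
  have h3 : (pairing ω (harmonicIndex k) : ℂ) * MvPowerSeries.coeff k (harmonic 0 H) = 0 := by
    by_cases hk : harmonicIndex k = 0
    · rw [hk, pairing_zero, Complex.ofReal_zero, zero_mul]
    · rw [hN k hk, mul_zero]
  rw [xi_orbit hω hS, poisson_C_mul_left, h1, map_neg, MvPowerSeries.coeff_C_mul, map_add,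
    coeff_poisson_quadratic, hN.coeff_poisson]
  change -(-Complex.I * (_ + Complex.I * MvPowerSeries.coeff k (normalFreq H _ * G))) = _
  rw [hG, mul_sub, map_sub, map_sub, h2]
  linear_combination ((pairing ω (harmonicIndex k) : ℂ) * MvPowerSeries.coeff k (orbit ω H δ) +
    MvPowerSeries.coeff k (normalFreq H (harmonicIndex k) * orbit ω H δ) -
      (pairing ω (harmonicIndex k) : ℂ) * MvPowerSeries.coeff k (harmonic 0 H)) * Complex.I_sq + h3

lemma isNormalizationOrbit_orbit (hω : Nonresonant ω)
    (hS : ∀ q ∈ support H, 0 ≤ pairing ω q) (hH : H ∈ Cubic n) :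
    IsNormalizationOrbit ω H (orbit ω H) where
  initial := orbit_zero ω H
  mem_cubic δ _ := orbit_mem_cubic hH δ
  equation δ _ k := by
    rw [coeff_neg_poisson_orbit hω hS]
    exact (hasDerivAt_coeff_orbit hH k δ).hasDerivWithinAt

/-! ### Uniqueness of the orbit -/

lemma xi_mem_cubic (hH : H ∈ Cubic n) : xi ω H ∈ Cubic n := fun k hk => by
  rw [coeff_xi, hH k hk, mul_zero]

/-- First derivatives of cubic series start in degree `2`. In a product of total degree `|k|` each
factor thus has degree at most `|k| - 2`, and comes from a coefficient of degree at most `|k| - 1`.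
-/
lemma coeff_pderiv_mul_congr {F F' G G' : Series n} (hF : F ∈ Cubic n) (hF' : F' ∈ Cubic n)
    (hG : G ∈ Cubic n) (hG' : G' ∈ Cubic n) {k : Var n →₀ ℕ}
    (hFF : ∀ l : Var n →₀ ℕ, l.degree < k.degree →
      MvPowerSeries.coeff l F = MvPowerSeries.coeff l F')
    (hGG : ∀ l : Var n →₀ ℕ, l.degree < k.degree →
      MvPowerSeries.coeff l G = MvPowerSeries.coeff l G') (i j : Var n) :
    MvPowerSeries.coeff k (MvPowerSeries.pderiv ℂ i F * MvPowerSeries.pderiv ℂ j G) =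
      MvPowerSeries.coeff k (MvPowerSeries.pderiv ℂ i F' * MvPowerSeries.pderiv ℂ j G') := by
  rw [MvPowerSeries.coeff_mul, MvPowerSeries.coeff_mul]
  refine Finset.sum_congr rfl fun p hp => ?_
  have hp' : p.1.degree + p.2.degree = k.degree := by
    rw [← map_add, Finset.HasAntidiagonal.mem_antidiagonal.mp hp]
  simp only [MvPowerSeries.coeff_pderiv]
  have e1 : (p.1 + Finsupp.single i 1).degree = p.1.degree + 1 := by
    rw [map_add, Finsupp.degree_single]
  have e2 : (p.2 + Finsupp.single j 1).degree = p.2.degree + 1 := by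
    rw [map_add, Finsupp.degree_single]
  by_cases h1 : p.1.degree < 2
  · rw [hF _ (by omega), hF' _ (by omega), zero_mul, zero_mul, zero_mul]
  by_cases h2 : p.2.degree < 2
  · rw [hG _ (by omega), hG' _ (by omega), zero_mul, mul_zero, mul_zero]
  rw [hFF _ (by omega), hGG _ (by omega)]

lemma coeff_poisson_xi_congr {H' : Series n} (hH : H ∈ Cubic n) (hH' : H' ∈ Cubic n)
    {k : Var n →₀ ℕ} (h : ∀ l : Var n →₀ ℕ, l.degree < k.degree →
      MvPowerSeries.coeff l H = MvPowerSeries.coeff l H') :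
    MvPowerSeries.coeff k (poisson (xi ω H) H) = MvPowerSeries.coeff k (poisson (xi ω H') H') := by
  have hx : ∀ l : Var n →₀ ℕ, l.degree < k.degree →
      MvPowerSeries.coeff l (xi ω H) = MvPowerSeries.coeff l (xi ω H') := fun l hl => by
    rw [coeff_xi, coeff_xi, h l hl]
  simp only [poisson, MvPowerSeries.coeff_C_mul, map_sum, map_sub]
  congr 1
  refine Finset.sum_congr rfl fun j _ => ?_
  rw [coeff_pderiv_mul_congr (xi_mem_cubic hH) (xi_mem_cubic hH') hH hH' hx h,
    coeff_pderiv_mul_congr (xi_mem_cubic hH) (xi_mem_cubic hH') hH hH' hx h]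

lemma real_sign_mul_self (x : ℝ) : Real.sign x * x = |x| := by
  rcases lt_trichotomy x 0 with h | rfl | h
  · rw [Real.sign_of_neg h, abs_of_neg h, neg_one_mul]
  · simp
  · rw [Real.sign_of_pos h, abs_of_pos h, one_mul]

lemma coeff_neg_poisson_xi (ω : Fin n → ℝ) (H : Series n) (k : Var n →₀ ℕ) :
    MvPowerSeries.coeff k (-poisson (xi ω H) (quadratic ω + H)) =
      -(|pairing ω (harmonicIndex k)| : ℝ) * MvPowerSeries.coeff k H -
        MvPowerSeries.coeff k (poisson (xi ω H) H) := by
  rw [map_neg, poisson_add_right, map_add, coeff_poisson_quadratic, coeff_xi, neg_add',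
    ← real_sign_mul_self]
  push_cast
  linear_combination ((Real.sign (pairing ω (harmonicIndex k)) : ℝ) : ℂ) *
    (pairing ω (harmonicIndex k) : ℂ) * MvPowerSeries.coeff k H * Complex.I_sq

/-- Induction on the degree: the nonlinear part of the equation for a coefficient involves only
lower degrees, where the orbits agree, so the difference solves a scalar homogeneous linear equation
with zero initial value. -/
lemma IsNormalizationOrbit.unique {γ γ' : ℝ → Series n} (h : IsNormalizationOrbit ω H γ)
    (h' : IsNormalizationOrbit ω H γ') {δ : ℝ} (hδ : 0 ≤ δ) : γ' δ = γ δ := by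
  have key : ∀ d : ℕ, ∀ k : Var n →₀ ℕ, k.degree = d → ∀ δ : ℝ, 0 ≤ δ →
      MvPowerSeries.coeff k (γ' δ) = MvPowerSeries.coeff k (γ δ) := by
    intro d
    induction d using Nat.strong_induction_on with
    | _ d ih =>
      intro k hk δ hδ
      rw [← sub_eq_zero]
      have hd : ∀ s : ℝ, 0 ≤ s → HasDerivWithinAt
          (fun s => MvPowerSeries.coeff k (γ' s) - MvPowerSeries.coeff k (γ s))
          (-(|pairing ω (harmonicIndex k)| : ℝ) *
            (MvPowerSeries.coeff k (γ' s) - MvPowerSeries.coeff k (γ s))) (Ici 0) s := by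
        intro s hs
        refine ((h'.equation s hs k).sub (h.equation s hs k)).congr_deriv ?_
        rw [coeff_neg_poisson_xi, coeff_neg_poisson_xi,
          coeff_poisson_xi_congr (h'.mem_cubic s hs) (h.mem_cubic s hs)
            fun l hl => ih l.degree (hk ▸ hl) l rfl s hs]
        ring
      refine eq_zero_of_abs_deriv_le_mul_abs_self_of_eq_zero_right
        (f := fun s => MvPowerSeries.coeff k (γ' s) - MvPowerSeries.coeff k (γ s))
        (K := |pairing ω (harmonicIndex k)|) (a := 0) (b := δ)
        (fun s hs => ((hd s hs.1).continuousWithinAt).mono fun t ht => ht.1)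
        (fun s hs => (hd s hs.1).mono fun t ht => hs.1.trans ht) ?_ (fun s _ => ?_) δ ⟨hδ, le_rfl⟩
      · simp only [h.initial, h'.initial, sub_self]
      · rw [norm_mul, norm_neg, Complex.norm_real, Real.norm_eq_abs, abs_abs]
  ext k
  exact key _ k rfl δ hδ

end Orbit

section Majorant

open ENNReal

variable {n : ℕ} {ω : Fin n → ℝ} {F G H P : Series n} {r : ENNReal}

/-! ### The weighted `ℓ¹`-norm -/

/-- The weighted `ℓ¹`-norm of the coefficients. -/
def l1Norm (r : ENNReal) (F : Series n) : ENNReal :=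
  ∑' k, ‖MvPowerSeries.coeff k F‖ₑ * r ^ k.degree

lemma coeff_le_l1Norm (r : ENNReal) (F : Series n) (k : Var n →₀ ℕ) :
    ‖MvPowerSeries.coeff k F‖ₑ * r ^ k.degree ≤ l1Norm r F :=
  ENNReal.le_tsum (f := fun k => ‖MvPowerSeries.coeff k F‖ₑ * r ^ k.degree) k

lemma l1Norm_mul_le (r : ENNReal) (F G : Series n) :
    l1Norm r (F * G) ≤ l1Norm r F * l1Norm r G := by
  have h : l1Norm r F * l1Norm r G = ∑' k, ∑ p ∈ Finset.HasAntidiagonal.antidiagonal k,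
      (‖MvPowerSeries.coeff p.1 F‖ₑ * r ^ p.1.degree) *
        (‖MvPowerSeries.coeff p.2 G‖ₑ * r ^ p.2.degree) := by
    rw [l1Norm, l1Norm, ← ENNReal.tsum_mul_right]
    simp only [← ENNReal.tsum_mul_left]
    rw [← ENNReal.tsum_prod (f := fun a b => (‖MvPowerSeries.coeff a F‖ₑ * r ^ a.degree) *
        (‖MvPowerSeries.coeff b G‖ₑ * r ^ b.degree)),
      ← Finset.HasAntidiagonal.sigmaAntidiagonalEquivProd.tsum_eq, ENNReal.tsum_sigma']
    refine tsum_congr fun k => ?_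
    rw [tsum_fintype]
    exact Finset.sum_coe_sort (Finset.HasAntidiagonal.antidiagonal k) fun p =>
      (‖MvPowerSeries.coeff p.1 F‖ₑ * r ^ p.1.degree) *
        (‖MvPowerSeries.coeff p.2 G‖ₑ * r ^ p.2.degree)
  rw [h]
  refine ENNReal.tsum_le_tsum fun k => ?_
  rw [MvPowerSeries.coeff_mul]
  calc _ ≤ (∑ p ∈ Finset.HasAntidiagonal.antidiagonal k,
        ‖MvPowerSeries.coeff p.1 F * MvPowerSeries.coeff p.2 G‖ₑ) * r ^ k.degree := by
        gcongr; exact enorm_sum_le _ _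
    _ = _ := by
        rw [Finset.sum_mul]
        refine Finset.sum_congr rfl fun p hp => ?_
        rw [← Finset.HasAntidiagonal.mem_antidiagonal.mp hp, map_add, pow_add, enorm_mul]
        ring

lemma l1Norm_one_le (r : ENNReal) : l1Norm r (1 : Series n) ≤ 1 := by
  classical
  rw [l1Norm, tsum_eq_single 0]
  · simp
  · intro k hk
    rw [MvPowerSeries.coeff_one, if_neg hk, enorm_zero, zero_mul]

lemma l1Norm_pow_le (r : ENNReal) (F : Series n) (m : ℕ) :
    l1Norm r (F ^ m) ≤ l1Norm r F ^ m := by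
  induction m with
  | zero => simpa using l1Norm_one_le r
  | succ m ih =>
    rw [pow_succ, pow_succ]
    exact (l1Norm_mul_le _ _ _).trans (by gcongr)

/-- The finite sums are enlarged to the full exponential series, the sums over `m` and `k` are
exchanged (free of charge in `ENNReal`), and submultiplicativity bounds each power. -/
lemma l1Norm_expSeries_le {p δ : ℝ} (hp : 0 ≤ p) (hδ : 0 ≤ δ)
    (h : l1Norm r P ≤ ENNReal.ofReal p) :
    l1Norm r (expSeries P δ) ≤ ENNReal.ofReal (Real.exp (δ * p)) := by
  have h1 : ∀ k : Var n →₀ ℕ, ‖MvPowerSeries.coeff k (expSeries P δ)‖ₑ * r ^ k.degree ≤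
      ∑' m : ℕ, ENNReal.ofReal (δ ^ m / m.factorial) *
        (‖MvPowerSeries.coeff k (P ^ m)‖ₑ * r ^ k.degree) := by
    intro k
    change ‖∑ m ∈ Finset.range (k.degree + 1), (-δ : ℂ) ^ m / m.factorial *
      MvPowerSeries.coeff k (P ^ m)‖ₑ * r ^ k.degree ≤ _
    refine le_trans ?_ (ENNReal.sum_le_tsum (Finset.range (k.degree + 1)))
    simp only [← mul_assoc]
    rw [← Finset.sum_mul]
    gcongr
    refine (enorm_sum_le _ _).trans (Finset.sum_le_sum fun m _ => ?_)
    rw [enorm_mul]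
    gcongr
    rw [← ofReal_norm]
    refine ENNReal.ofReal_le_ofReal (le_of_eq ?_)
    rw [norm_div, norm_pow, norm_neg, Complex.norm_real, Real.norm_of_nonneg hδ,
      Complex.norm_natCast]
  calc l1Norm r (expSeries P δ)
      ≤ ∑' k : Var n →₀ ℕ, ∑' m : ℕ, ENNReal.ofReal (δ ^ m / m.factorial) *
        (‖MvPowerSeries.coeff k (P ^ m)‖ₑ * r ^ k.degree) := ENNReal.tsum_le_tsum h1
    _ = ∑' m : ℕ, ENNReal.ofReal (δ ^ m / m.factorial) * l1Norm r (P ^ m) := by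
        rw [ENNReal.tsum_comm]
        exact tsum_congr fun m => ENNReal.tsum_mul_left
    _ ≤ ∑' m : ℕ, ENNReal.ofReal ((δ * p) ^ m / m.factorial) := by
        refine ENNReal.tsum_le_tsum fun m => ?_
        calc _ ≤ ENNReal.ofReal (δ ^ m / m.factorial) * ENNReal.ofReal p ^ m := by
              gcongr
              exact (l1Norm_pow_le _ _ _).trans (by gcongr)
          _ = _ := by
              rw [← ENNReal.ofReal_pow hp, ← ENNReal.ofReal_mul (by positivity), mul_pow]
              congr 1
              ring
    _ = ENNReal.ofReal (Real.exp (δ * p)) := by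
        rw [← ENNReal.ofReal_tsum_of_nonneg (fun m => by positivity)
          (Real.summable_pow_div_factorial _), Real.exp_eq_exp_ℝ, NormedSpace.exp_eq_tsum_div]

/-! ### From coefficient bounds to the weighted norm -/

lemma CoeffBound.l1Norm_le {c b t : ℝ} (h : CoeffBound c b F) (hb : 0 ≤ b) (ht : 0 ≤ t)
    (hbt : b * t < 1) :
    l1Norm (ENNReal.ofReal t) F ≤ ENNReal.ofReal (c * geom n (b * t)) := by
  have hc := h.nonneg
  rw [geom, ← tsum_mul_left, ENNReal.ofReal_tsum_of_nonneg (fun k => by positivity)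
    ((summable_pow_degree (by positivity) hbt).mul_left c)]
  refine ENNReal.tsum_le_tsum fun k => ?_
  rw [← ofReal_norm, ← ENNReal.ofReal_pow ht, ← ENNReal.ofReal_mul (norm_nonneg _),
    mul_pow, ← mul_assoc]
  exact ENNReal.ofReal_le_ofReal (mul_le_mul_of_nonneg_right (h k) (by positivity))

/-- Every term present has degree at least `1`, so shrinking the radius by `ε` gains at least a
factor `ε`. -/
lemma CoeffBound.l1Norm_le_of_coeff_zero {c b t ε : ℝ} (h : CoeffBound c b F) (hb : 0 ≤ b)
    (ht : 0 ≤ t) (hbt : b * t < 1) (h0 : MvPowerSeries.coeff 0 F = 0) (hε : 0 ≤ ε) (hε1 : ε ≤ 1) :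
    l1Norm (ENNReal.ofReal (ε * t)) F ≤ ENNReal.ofReal (ε * (c * geom n (b * t))) := by
  rw [ENNReal.ofReal_mul (q := c * geom n (b * t)) hε]
  refine le_trans ?_ (mul_le_mul_right (h.l1Norm_le hb ht hbt) (ENNReal.ofReal ε))
  rw [l1Norm, l1Norm, ← ENNReal.tsum_mul_left]
  refine ENNReal.tsum_le_tsum fun k => ?_
  by_cases hk : k = 0
  · rw [hk, h0]; simp
  · have : k.degree ≠ 0 := fun h => hk ((Finsupp.degree_eq_zero_iff _).mp h)
    rw [mul_left_comm, ENNReal.ofReal_mul hε, mul_pow]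
    gcongr
    exact pow_le_of_le_one zero_le (ENNReal.ofReal_le_one.mpr hε1) this

lemma CoeffBound.harmonic {c b : ℝ} (h : CoeffBound c b H) (hb : 0 ≤ b) (q : Fin n → ℤ) :
    CoeffBound c b (harmonic q H) := fun k => by
  rw [coeff_harmonic]
  split_ifs
  · exact h k
  · have := h.nonneg
    rw [norm_zero]; positivity

lemma CoeffBound.actionGrad {c b : ℝ} (h : CoeffBound c b F) (j : Fin n) :
    CoeffBound (c * b ^ 2) (2 * b) (actionGrad F j) := fun k => by
  have h1 : (k (Sum.inl j) : ℝ) + 1 ≤ 2 ^ k.degree := by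
    have : k (Sum.inl j) + 1 ≤ 2 ^ k.degree :=
      (Nat.succ_le_succ (Finsupp.le_degree _ k)).trans Nat.lt_two_pow_self
    exact_mod_cast this
  have h2 : ‖(k (Sum.inl j) : ℂ) + 1‖ = (k (Sum.inl j) : ℝ) + 1 := by
    rw [← Nat.cast_add_one, Complex.norm_natCast]; push_cast; rfl
  have h3 := h (k + Finsupp.single (Sum.inl j) 1 + Finsupp.single (Sum.inr j) 1)
  rw [map_add, map_add, Finsupp.degree_single, Finsupp.degree_single] at h3
  have := h.nonneg
  rw [coeff_actionGrad, norm_mul, h2]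
  calc _ ≤ 2 ^ k.degree * (c * b ^ (k.degree + 1 + 1)) := by gcongr
    _ = _ := by rw [mul_pow]; ring

lemma l1_nonneg (q : Fin n → ℤ) : 0 ≤ l1 q := Finset.sum_nonneg fun _ _ => abs_nonneg _

lemma one_le_l1 {q : Fin n → ℤ} (hq : q ≠ 0) : 1 ≤ l1 q := by
  obtain ⟨j, hj⟩ := Function.ne_iff.mp hq
  have h1 : (1 : ℝ) ≤ |(q j : ℝ)| := by exact_mod_cast Int.one_le_abs hj
  exact h1.trans (Finset.single_le_sum (f := fun j => |(q j : ℝ)|) (fun _ _ => abs_nonneg _)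
    (Finset.mem_univ j))

/-- The bound is linear in `|q|`, exactly the growth that the small divisor condition can
compensate. -/
lemma l1Norm_freqSeries_le {N : Series n} {η : ℝ} (q : Fin n → ℤ)
    (h : ∀ j, l1Norm r (actionGrad N j) ≤ ENNReal.ofReal η) :
    l1Norm r (freqSeries N q) ≤ ENNReal.ofReal (l1 q * η) := by
  have h1 : l1Norm r (freqSeries N q) ≤
      ∑ j, ENNReal.ofReal |(q j : ℝ)| * l1Norm r (actionGrad N j) := by
    simp only [l1Norm, ← ENNReal.tsum_mul_left]
    rw [← Summable.tsum_finsetSum fun _ _ => ENNReal.summable]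
    refine ENNReal.tsum_le_tsum fun k => ?_
    rw [freqSeries, map_sum]
    simp only [← mul_assoc]
    rw [← Finset.sum_mul]
    gcongr
    refine (enorm_sum_le _ _).trans (Finset.sum_le_sum fun j _ => ?_)
    rw [MvPowerSeries.coeff_C_mul, enorm_mul]
    gcongr
    rw [← ofReal_norm, Complex.norm_intCast]
  refine h1.trans ?_
  calc _ ≤ ∑ j, ENNReal.ofReal |(q j : ℝ)| * ENNReal.ofReal η := by
        gcongr with j; exact h j
    _ = _ := by
        rw [← Finset.sum_mul, ← ENNReal.ofReal_sum_of_nonneg fun _ _ => abs_nonneg _,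
          ENNReal.ofReal_mul (l1_nonneg q)]
        rfl

/-! ### Exponential decay of the nonzero harmonics -/

lemma le_pairing_of_lt_smallDivisorInf {c : ℝ} (hc : (c : EReal) < smallDivisorInf ω H)
    (hS : ∀ q ∈ support H, 0 ≤ pairing ω q) {q : Fin n → ℤ} (hq : q ∈ support H) (hq0 : q ≠ 0) :
    c * l1 q ≤ pairing ω q := by
  have h1 : (c : EReal) ≤ ((|pairing ω q| / l1 q : ℝ) : EReal) :=
    hc.le.trans (iInf₂_le q ⟨hq, hq0⟩)
  rw [EReal.coe_le_coe_iff, abs_of_nonneg (hS q hq),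
    le_div_iff₀ (zero_lt_one.trans_le (one_le_l1 hq0))] at h1
  exact h1

/-- The decay `c |q|` from the divisors beats the growth `c |q| / 2` from the frequency shift,
uniformly in `q ≠ 0` since `|q| ≥ 1`. -/
theorem exists_coeffBound_orbit (hA : H ∈ Analytic n) (hF : H ∈ Cubic n)
    (hS : ∀ q ∈ support H, 0 ≤ pairing ω q) (hc : 0 < smallDivisorInf ω H) :
    ∃ C b κ : ℝ, 0 < b ∧ 0 < κ ∧ CoeffBound C b (harmonic 0 H) ∧
      ∀ δ : ℝ, 0 ≤ δ → CoeffBound (C * Real.exp (-κ * δ)) b (orbit ω H δ - harmonic 0 H) := by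
  obtain ⟨c₁, a, hca⟩ := hA
  set b₁ := Real.exp a with hb₁
  have hb₁0 : 0 < b₁ := Real.exp_pos a
  have hH : CoeffBound c₁ b₁ H := fun k => by
    rw [hb₁, ← Real.exp_nat_mul, mul_comm (k.degree : ℝ) a]
    exact hca k
  have hc₁ := hH.nonneg
  -- The infimum may be `⊤`, so a positive real number below it is used instead.
  obtain ⟨c, hc0, hc1⟩ := EReal.lt_iff_exists_real_btwn.mp hc
  have hc0' : 0 < c := by exact_mod_cast hc0
  -- a radius at which the frequency shift is at most `c / 2`
  set t := 1 / (4 * b₁) with ht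
  have ht0 : 0 < t := by positivity
  set A := c₁ * b₁ ^ 2 * geom n (2 * b₁ * t) with hAdef
  have hA0 : 0 ≤ A := mul_nonneg (by positivity) (geom_nonneg n (by positivity))
  set ε := min 1 (c / (2 * (A + 1))) with hε
  have hε0 : 0 < ε := lt_min one_pos (by positivity)
  have hεA : ε * A ≤ c / 2 := by
    calc ε * A ≤ c / (2 * (A + 1)) * (A + 1) := by
          gcongr
          · exact min_le_right _ _
          · linarith
      _ = c / 2 := by field_simp
  have hbt : 2 * b₁ * t = 1 / 2 := by rw [ht]; field_simp; norm_num
  have hgrad : ∀ j, l1Norm (ENNReal.ofReal (ε * t)) (actionGrad (harmonic 0 H) j) ≤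
      ENNReal.ofReal (c / 2) := fun j =>
    (((hH.harmonic hb₁0.le 0).actionGrad j).l1Norm_le_of_coeff_zero (by positivity) ht0.le
      (by rw [hbt]; norm_num) (by
        rw [coeff_actionGrad, harmonic_mem_cubic hF 0 _ (by
          simp [map_add, Finsupp.degree_single]), mul_zero]) hε0.le (min_le_left _ _)).trans
      (ENNReal.ofReal_le_ofReal hεA)
  set r := ε * t with hr
  have hr0 : 0 < r := by positivity
  have hbr : b₁ * r < 1 := by
    have : ε ≤ 1 := min_le_left _ _
    have h2 : b₁ * r = ε * (2 * b₁ * t) / 2 := by rw [hr]; ring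
    rw [h2, hbt]; linarith
  set C := c₁ * geom n (b₁ * r) with hC
  have hC0 : 0 ≤ C := mul_nonneg hc₁ (geom_nonneg n (by positivity))
  have hHl : l1Norm (ENNReal.ofReal r) H ≤ ENNReal.ofReal C := hH.l1Norm_le hb₁0.le hr0.le hbr
  -- A single term is at most the whole norm (Cauchy's estimate), which returns to coefficient
  -- bounds with rate `1 / r`.
  have extract : ∀ (F : Series n) (B : ℝ), 0 ≤ B → l1Norm (ENNReal.ofReal r) F ≤ ENNReal.ofReal B →
      CoeffBound B (1 / r) F := by
    intro F B hB hFB k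
    have h1 := (coeff_le_l1Norm (ENNReal.ofReal r) F k).trans hFB
    rw [← ofReal_norm, ← ENNReal.ofReal_pow hr0.le, ← ENNReal.ofReal_mul (norm_nonneg _),
      ENNReal.ofReal_le_ofReal_iff hB, ← le_div_iff₀ (by positivity)] at h1
    rwa [one_div, inv_pow, ← div_eq_mul_inv]
  refine ⟨C, 1 / r, c / 2, by positivity, by positivity,
    (extract H C hC0 hHl).harmonic (by positivity) 0, fun δ hδ k => ?_⟩
  have hpos : 0 ≤ C * Real.exp (-(c / 2) * δ) * (1 / r) ^ k.degree := by positivity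
  rw [map_sub, coeff_harmonic]
  split_ifs with hk
  · rwa [coeff_orbit_of_harmonicIndex_eq_zero hk, sub_self, norm_zero]
  by_cases hs : harmonicIndex k ∈ support H
  swap
  · rwa [coeff_orbit_of_notMem hs, sub_zero, norm_zero]
  set q := harmonicIndex k with hq
  have hE : l1Norm (ENNReal.ofReal r) (expSeries (normalFreq H q) δ * H) ≤
      ENNReal.ofReal (Real.exp (δ * (l1 q * (c / 2))) * C) := by
    rw [ENNReal.ofReal_mul (Real.exp_pos _).le]
    refine (l1Norm_mul_le _ _ _).trans ?_
    gcongr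
    exact l1Norm_expSeries_le (mul_nonneg (l1_nonneg q) (by positivity)) hδ
      (l1Norm_freqSeries_le q hgrad)
  have hk1 := extract _ _ (by positivity) hE k
  have hp := le_pairing_of_lt_smallDivisorInf hc1 hS hs hk
  have hl := one_le_l1 hk
  rw [sub_zero, coeff_orbit, norm_mul, Complex.norm_exp]
  have hre : (-(pairing ω (harmonicIndex k) : ℂ) * δ).re = -pairing ω q * δ := by
    rw [← Complex.ofReal_neg, ← Complex.ofReal_mul, Complex.ofReal_re]
  rw [hre]
  calc _ ≤ Real.exp (-pairing ω q * δ) *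
        (Real.exp (δ * (l1 q * (c / 2))) * C * (1 / r) ^ k.degree) := by gcongr
    _ = C * Real.exp (-pairing ω q * δ + δ * (l1 q * (c / 2))) * (1 / r) ^ k.degree := by
        rw [Real.exp_add]; ring
    _ ≤ C * Real.exp (-(c / 2) * δ) * (1 / r) ^ k.degree := by
        gcongr
        nlinarith [mul_le_mul_of_nonneg_left hp hδ, mul_le_mul_of_nonneg_left hl
          (mul_nonneg hδ hc0'.le)]

end Majorant

section Osgood

open Metric MeasureTheory Complex

variable {E : Type*} [NormedAddCommGroup E] [NormedSpace ℂ E]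

/-! ### Complex differentiable functions of several variables are analytic -/

lemma cons_mem_ball_iff {m : ℕ} {c : Fin (m + 1) → ℂ} {R : ℝ} (hR : 0 < R) {x : ℂ}
    {y : Fin m → ℂ} :
    (Fin.cons x y : Fin (m + 1) → ℂ) ∈ ball c R ↔ x ∈ ball (c 0) R ∧ y ∈ ball (c ∘ Fin.succ) R := by
  simp only [mem_ball, dist_pi_lt_iff hR, Fin.forall_fin_succ, Fin.cons_zero, Fin.cons_succ,
    Function.comp_apply]

lemma dist_torusMap {m : ℕ} (c : Fin m → ℂ) {R : ℝ} (hR : 0 < R) (θ : Fin m → ℝ) (i : Fin m) :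
    dist (torusMap c (fun _ => R) θ i) (c i) = R := by
  simp [torusMap, dist_eq_norm, Complex.norm_exp_ofReal_mul_I, abs_of_pos hR]

lemma torusMap_mem_ball {m : ℕ} (c : Fin m → ℂ) {R R' : ℝ} (hR : 0 < R) (hRR : R < R')
    (θ : Fin m → ℝ) : torusMap c (fun _ => R) θ ∈ ball c R' := by
  rw [mem_ball, dist_pi_lt_iff (hR.trans hRR)]
  exact fun i => (dist_torusMap c hR θ i).trans_lt hRR

lemma torusMap_sub_ne_zero {m : ℕ} {c w : Fin m → ℂ} {R : ℝ} (hR : 0 < R) (hw : w ∈ ball c R)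
    (θ : Fin m → ℝ) (i : Fin m) : torusMap c (fun _ => R) θ i - w i ≠ 0 := by
  intro h
  have h1 := (dist_pi_lt_iff hR).mp (mem_ball.mp hw) i
  rw [← sub_eq_zero.mp h, dist_torusMap c hR] at h1
  exact lt_irrefl _ h1

lemma continuous_torusMap {m : ℕ} (c : Fin m → ℂ) (R : Fin m → ℝ) : Continuous (torusMap c R) := by
  unfold torusMap; fun_prop

/-- **Cauchy integral formula** on a polydisk. -/
theorem torusIntegral_prod_sub_inv_smul [CompleteSpace E] : ∀ {m : ℕ} {f : (Fin m → ℂ) → E}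
    {c w : Fin m → ℂ} {R R' : ℝ}, 0 < R → R < R' → DifferentiableOn ℂ f (ball c R') →
    w ∈ ball c R → torusIntegral (fun y => (∏ i, (y i - w i)⁻¹) • f y) c (fun _ => R) =
      (2 * Real.pi * I : ℂ) ^ m • f w := by
  intro m
  induction m with
  | zero =>
    intro f c w R R' _ _ _ _
    rw [torusIntegral_dim0]
    simp [Subsingleton.elim c w]
  | succ m ih =>
    intro f c w R R' hR hRR hf hw
    have hw' : w = Fin.cons (w 0) (w ∘ Fin.succ) := (Fin.cons_self_tail w).symm
    have hw2 : w 0 ∈ ball (c 0) R ∧ w ∘ Fin.succ ∈ ball (c ∘ Fin.succ) R := by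
      rw [← cons_mem_ball_iff hR, ← hw']; exact hw
    have hint : TorusIntegrable (fun y => (∏ i, (y i - w i)⁻¹) • f y) c (fun _ => R) := by
      refine ContinuousOn.integrableOn_compact isCompact_Icc (Continuous.continuousOn ?_)
      refine Continuous.smul (continuous_finsetProd _ fun i _ => Continuous.inv₀ ?_
        fun θ => torusMap_sub_ne_zero hR hw θ i) ?_
      · have := continuous_torusMap c fun _ : Fin (m + 1) => R
        fun_prop
      · exact hf.continuousOn.comp_continuous (continuous_torusMap c _)
          fun θ => torusMap_mem_ball c hR hRR θ
    rw [torusIntegral_succ hint]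
    -- With the first variable frozen on its circle, the induction hypothesis evaluates the
    -- remaining integrals; the one-variable Cauchy formula then does the first.
    have hinner : ∀ x ∈ sphere (c 0) R,
        torusIntegral (fun y => (∏ i, ((Fin.cons x y : Fin (m + 1) → ℂ) i - w i)⁻¹) •
          f (Fin.cons x y)) (c ∘ Fin.succ) ((fun _ => R) ∘ Fin.succ) =
        (2 * Real.pi * I : ℂ) ^ m • ((x - w 0)⁻¹ • f (Fin.cons x (w ∘ Fin.succ))) := by
      intro x hx
      have hx' : x ∈ ball (c 0) R' := by rw [mem_ball, mem_sphere.mp hx]; exact hRR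
      have hd : DifferentiableOn ℂ (fun y : Fin m → ℂ => f (Fin.cons x y))
          (ball (c ∘ Fin.succ) R') := by
        refine hf.comp (t := ball c R') (Differentiable.differentiableOn ?_)
          fun y hy => (cons_mem_ball_iff (hR.trans hRR)).mpr ⟨hx', hy⟩
        refine differentiable_pi.mpr fun i => ?_
        refine Fin.cases ?_ (fun i => ?_) i
        · simp
        · simp only [Fin.cons_succ]; fun_prop
      have := ih hR hRR hd hw2.2
      rw [smul_comm, ← this, ← torusIntegral_smul]
      simp only [Fin.prod_univ_succ, Fin.cons_zero, Fin.cons_succ, mul_smul]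
      rfl
    rw [circleIntegral.integral_congr hR.le hinner, circleIntegral.integral_smul]
    have hd : DifferentiableOn ℂ (fun x : ℂ => f (Fin.cons x (w ∘ Fin.succ))) (ball (c 0) R') := by
      refine hf.comp (t := ball c R') (Differentiable.differentiableOn ?_)
        fun x hx => (cons_mem_ball_iff (hR.trans hRR)).mpr
          ⟨hx, ball_subset_ball hRR.le hw2.2⟩
      refine differentiable_pi.mpr fun i => ?_
      refine Fin.cases ?_ (fun i => ?_) i
      · simp only [Fin.cons_zero]; fun_prop
      · simp
    have hd' : DiffContOnCl ℂ (fun x : ℂ => f (Fin.cons x (w ∘ Fin.succ))) (ball (c 0) R) :=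
      (hd.mono (closure_ball_subset_closedBall.trans (closedBall_subset_ball hRR))).diffContOnCl
    rw [hd'.circleIntegral_sub_inv_smul hw2.1, ← hw', smul_smul, ← pow_succ]

/-- Integration of continuous functions against a fixed vector-valued continuous function. -/
def integralSMulCLM {K : Type*} [TopologicalSpace K] [CompactSpace K] [MeasurableSpace K]
    [BorelSpace K] (μ : Measure K) [IsFiniteMeasure μ] (F : C(K, E))
    [SecondCountableTopology K] [TopologicalSpace.PseudoMetrizableSpace K] : C(K, ℂ) →L[ℂ] E :=
  have hint : ∀ g : C(K, ℂ), Integrable (fun θ => g θ • F θ) μ := fun g =>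
    (g.continuous.smul F.continuous).integrable_of_hasCompactSupport
      (HasCompactSupport.of_compactSpace _)
  LinearMap.mkContinuous
    { toFun := fun g => ∫ θ, g θ • F θ ∂μ
      map_add' := fun g g' => by
        rw [← integral_add (hint g) (hint g')]
        simp [add_smul]
      map_smul' := fun a g => by
        rw [RingHom.id_apply, ← integral_smul]
        simp [mul_smul] }
    (‖F‖ * μ.real univ) fun g => by
      refine (norm_integral_le_of_norm_le_const (C := ‖g‖ * ‖F‖)
        (Eventually.of_forall fun θ => ?_)).trans
        (le_of_eq (by ring))
      rw [norm_smul]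
      exact mul_le_mul (g.norm_coe_le_norm θ) (F.norm_coe_le_norm θ) (norm_nonneg _) (norm_nonneg _)

/-- The Cauchy kernel is regarded as a map `κ` from points `w` to the Banach algebra of continuous
functions on the parameter cube of the torus. Inversion there is analytic, so `κ` is analytic at
`c`, and Cauchy's formula writes `f` as a continuous linear map applied to `κ`. No power series has
to be summed by hand. -/
lemma analyticAt_of_differentiableOn_ball [CompleteSpace E] {m : ℕ} {f : (Fin m → ℂ) → E}
    {c : Fin m → ℂ} {R' : ℝ} (hR' : 0 < R') (hf : DifferentiableOn ℂ f (ball c R')) :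
    AnalyticAt ℂ f c := by
  obtain ⟨R, hR, hRR⟩ := exists_between hR'
  set K : Set (Fin m → ℝ) := Icc 0 fun _ => 2 * Real.pi with hK
  have : CompactSpace K := isCompact_iff_compactSpace.mp isCompact_Icc
  set μ : Measure K := Measure.comap Subtype.val volume with hμ
  have : IsFiniteMeasure μ := ⟨by
    rw [hμ, comap_subtype_coe_apply measurableSet_Icc, Subtype.coe_image_univ]
    exact isCompact_Icc.measure_lt_top⟩
  have hcont : Continuous fun θ : K => torusMap c (fun _ => R) θ :=
    (continuous_torusMap c _).comp continuous_subtype_val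
  let F : C(K, E) := ⟨fun θ => (∏ i, (R : ℂ) * Complex.exp ((θ : Fin m → ℝ) i * I) * I) •
      f (torusMap c (fun _ => R) θ), by
    refine Continuous.smul (continuous_finsetProd _ fun i _ => ?_) ?_
    · have : Continuous fun θ : K => (θ : Fin m → ℝ) i :=
        (continuous_apply i).comp continuous_subtype_val
      exact (continuous_const.mul
        ((Complex.continuous_ofReal.comp this).mul continuous_const).cexp).mul continuous_const
    · exact hf.continuousOn.comp_continuous hcont fun θ => torusMap_mem_ball c hR hRR θ⟩
  let u : Fin m → C(K, ℂ) := fun i => ⟨fun θ => torusMap c (fun _ => R) θ i, by fun_prop⟩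
  -- `Ring.inverse` is zero off the units, but for `w` in the ball every factor is a unit, as the
  -- torus avoids the values `w i`.
  let κ : (Fin m → ℂ) → C(K, ℂ) := fun w => ∏ i, Ring.inverse (u i - algebraMap ℂ C(K, ℂ) (w i))
  have hunit : ∀ w ∈ ball c R, ∀ i, IsUnit (u i - algebraMap ℂ C(K, ℂ) (w i)) := fun w hw i =>
    ContinuousMap.isUnit_iff_forall_ne_zero _ |>.mpr fun θ => torusMap_sub_ne_zero hR hw θ i
  have hκ : ∀ w ∈ ball c R, ∀ θ : K, κ w θ = ∏ i, (torusMap c (fun _ => R) θ i - w i)⁻¹ := by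
    intro w hw θ
    simp only [κ, ContinuousMap.prod_apply]
    refine Finset.prod_congr rfl fun i _ => ?_
    have h1 := congrArg (fun g : C(K, ℂ) => g θ) (Ring.inverse_mul_cancel _ (hunit w hw i))
    exact eq_inv_of_mul_eq_one_left h1
  have hκa : AnalyticAt ℂ κ c := by
    refine Finset.analyticAt_fun_prod _ fun i _ => ?_
    have h1 := analyticAt_inverse (𝕜 := ℂ) (hunit c (mem_ball_self hR) i).unit
    rw [IsUnit.unit_spec] at h1
    refine AnalyticAt.fun_comp (f := fun w : Fin m → ℂ => u i - algebraMap ℂ C(K, ℂ) (w i)) h1 ?_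
    have h2 : AnalyticAt ℂ (fun w : Fin m → ℂ => algebraMap ℂ C(K, ℂ) (w i)) c :=
      ((Algebra.linearMap ℂ C(K, ℂ)).toContinuousLinearMap.comp
        (ContinuousLinearMap.proj (R := ℂ) (φ := fun _ : Fin m => ℂ) i)).analyticAt c
    exact analyticAt_const.sub h2
  have key : ∀ w ∈ ball c R,
      f w = ((2 * Real.pi * I : ℂ) ^ m)⁻¹ • integralSMulCLM μ F (κ w) := by
    intro w hw
    have h1 : integralSMulCLM μ F (κ w) =
        torusIntegral (fun y => (∏ i, (y i - w i)⁻¹) • f y) c (fun _ => R) := by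
      rw [torusIntegral, ← integral_subtype_comap measurableSet_Icc]
      refine integral_congr_ae (Eventually.of_forall fun θ => ?_)
      change κ w θ • ((∏ i, (R : ℂ) * Complex.exp ((θ : Fin m → ℝ) i * I) * I) •
        f (torusMap c (fun _ => R) θ)) = _
      rw [hκ w hw, smul_comm]
    rw [h1, torusIntegral_prod_sub_inv_smul hR hRR hf hw, inv_smul_smul₀]
    exact pow_ne_zero _ (by simp [Real.pi_ne_zero, I_ne_zero])
  have h2 : AnalyticAt ℂ (fun w => ((2 * Real.pi * I : ℂ) ^ m)⁻¹ •
      integralSMulCLM μ F (κ w)) c :=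
    analyticAt_const.smul (((integralSMulCLM μ F).analyticAt _).comp hκa)
  refine h2.congr ?_
  filter_upwards [ball_mem_nhds c hR] with w hw
  exact (key w hw).symm

/-- **Osgood's lemma**: a complex differentiable function of several variables is analytic. -/
theorem analyticOnNhd_of_differentiableOn [CompleteSpace E] {ι : Type*} [Fintype ι]
    {f : (ι → ℂ) → E} {U : Set (ι → ℂ)} (hU : IsOpen U) (hf : DifferentiableOn ℂ f U) :
    AnalyticOnNhd ℂ f U := by
  intro x hx
  let L : (ι → ℂ) ≃L[ℂ] (Fin (Fintype.card ι) → ℂ) :=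
    ContinuousLinearEquiv.piCongrLeft ℂ (fun _ => ℂ) (Fintype.equivFin ι)
  have hV : IsOpen (L.symm ⁻¹' U) := hU.preimage L.symm.continuous
  have hxV : L x ∈ L.symm ⁻¹' U := by simpa using hx
  obtain ⟨R, hR, hRV⟩ := Metric.isOpen_iff.mp hV _ hxV
  have h1 : AnalyticAt ℂ (f ∘ L.symm) (L x) := analyticAt_of_differentiableOn_ball hR
    (hf.comp L.symm.differentiable.differentiableOn fun y hy => hRV hy)
  have h2 : f = (f ∘ L.symm) ∘ L := by funext y; simp
  rw [h2]
  exact h1.comp (L.toContinuousLinearMap.analyticAt x)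

end Osgood

section Flow

open Metric

variable {E : Type*} [NormedAddCommGroup E] [NormedSpace ℂ E]
  {Y : ℝ → E → E} {A : ℝ → E → E →L[ℂ] E} {R K : ℝ} {Z : ℝ → E → E}

/-! ### Flows of small time-dependent vector fields -/

/-- A vector field on a ball over the time interval `[0, 1]` which vanishes to second order at the
origin and whose derivative is at most `1 / 2`. -/
structure IsSmallField (Y : ℝ → E → E) (A : ℝ → E → E →L[ℂ] E) (R K : ℝ) : Prop where
  radius_pos : 0 < R
  const_nonneg : 0 ≤ K
  hasFDerivAt : ∀ s ∈ Icc (0 : ℝ) 1, ∀ x ∈ ball (0 : E) R, HasFDerivAt (Y s) (A s x) x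
  field_zero : ∀ s ∈ Icc (0 : ℝ) 1, Y s 0 = 0
  deriv_zero : ∀ s ∈ Icc (0 : ℝ) 1, A s 0 = 0
  lipschitz : ∀ s ∈ Icc (0 : ℝ) 1, ∀ x ∈ ball (0 : E) R, ∀ y ∈ ball (0 : E) R,
    ‖A s x - A s y‖ ≤ K * ‖x - y‖
  small : K * R ≤ 1 / 2
  continuousOn_field : ∀ x ∈ ball (0 : E) R, ContinuousOn (fun s => Y s x) (Icc 0 1)
  continuousOn_deriv : ∀ x ∈ ball (0 : E) R, ContinuousOn (fun s => A s x) (Icc 0 1)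

/-- `Z` is the flow of `Y` from the ball of radius `R / 4` to the ball of radius `R / 2`. -/
structure IsFlow (Y : ℝ → E → E) (R : ℝ) (Z : ℝ → E → E) : Prop where
  initial : ∀ x ∈ closedBall (0 : E) (R / 4), Z 0 x = x
  mem : ∀ x ∈ closedBall (0 : E) (R / 4), ∀ s ∈ Icc (0 : ℝ) 1, Z s x ∈ closedBall (0 : E) (R / 2)
  deriv : ∀ x ∈ closedBall (0 : E) (R / 4), ∀ s ∈ Icc (0 : ℝ) 1,
    HasDerivWithinAt (fun s => Z s x) (Y s (Z s x)) (Icc 0 1) s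

/-- The Picard fixed point is sought among curves that stay in the ball, so the solution comes with
its confinement. -/
lemma exists_solution_mem_closedBall [CompleteSpace E] {f : ℝ → E → E} {tmin tmax : ℝ}
    {t₀ : Icc tmin tmax} {x₀ x : E} {a r L K : NNReal} (hf : IsPicardLindelof f t₀ x₀ a r L K)
    (hx : x ∈ closedBall x₀ r) :
    ∃ α : ℝ → E, α t₀ = x ∧ ∀ t ∈ Icc tmin tmax, α t ∈ closedBall x₀ a ∧
      HasDerivWithinAt α (f t (α t)) (Icc tmin tmax) t := by
  obtain ⟨α, hα⟩ := ODE.FunSpace.exists_isFixedPt_next hf hx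
  refine ⟨α.compProj, by rw [ODE.FunSpace.compProj_val, ← hα, ODE.FunSpace.next_apply₀],
    fun t ht => ⟨α.compProj_mem_closedBall hf.mul_max_le, ?_⟩⟩
  refine (ODE.hasDerivWithinAt_picard_Icc t₀.2 hf.continuousOn_uncurry
    α.continuous_compProj.continuousOn (fun _ _ => α.compProj_mem_closedBall hf.mul_max_le)
    x ht).congr_of_mem (fun t' ht' => ?_) ht
  nth_rw 1 [← hα]
  rw [ODE.FunSpace.compProj_of_mem ht', ODE.FunSpace.next_apply]

lemma hasDerivWithinAt_Ici_of_Icc {f : ℝ → E} {f' : E} {s : ℝ} (hs : s ∈ Ico (0 : ℝ) 1)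
    (h : HasDerivWithinAt f f' (Icc 0 1) s) : HasDerivWithinAt f f' (Ici s) s :=
  h.mono_of_mem_nhdsWithin (mem_of_superset (Icc_mem_nhdsGE_of_mem ⟨le_rfl, hs.2⟩)
    (Icc_subset_Icc_left hs.1))

lemma hasDerivWithinAt_Iic_of_Icc {f : ℝ → E} {f' : E} {s : ℝ} (hs : s ∈ Ioc (0 : ℝ) 1)
    (h : HasDerivWithinAt f f' (Icc 0 1) s) : HasDerivWithinAt f f' (Iic s) s :=
  h.mono_of_mem_nhdsWithin (mem_of_superset (Icc_mem_nhdsLE_of_mem ⟨hs.1, le_rfl⟩)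
    (Icc_subset_Icc_right hs.2))

lemma IsFlow.continuousOn (hZ : IsFlow Y R Z) {x : E} (hx : x ∈ closedBall (0 : E) (R / 4)) :
    ContinuousOn (fun s => Z s x) (Icc 0 1) :=
  fun s hs => (hZ.deriv x hx s hs).continuousWithinAt

namespace IsSmallField

lemma zero_mem (h : IsSmallField Y A R K) : (0 : E) ∈ ball (0 : E) R := mem_ball_self h.radius_pos

lemma norm_deriv_le (h : IsSmallField Y A R K) {s : ℝ} (hs : s ∈ Icc (0 : ℝ) 1) {x : E}
    (hx : x ∈ ball (0 : E) R) :
    ‖A s x‖ ≤ 1 / 2 := by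
  have h1 := h.lipschitz s hs x hx 0 h.zero_mem
  rw [h.deriv_zero s hs, sub_zero, sub_zero] at h1
  have h2 := mem_ball_zero_iff.mp hx
  nlinarith [h.small, mul_le_mul_of_nonneg_left h2.le h.const_nonneg]

lemma norm_field_sub_le (h : IsSmallField Y A R K) {s : ℝ} (hs : s ∈ Icc (0 : ℝ) 1) {x y : E}
    (hx : x ∈ ball (0 : E) R)
    (hy : y ∈ ball (0 : E) R) : ‖Y s x - Y s y‖ ≤ 1 / 2 * ‖x - y‖ :=
  (convex_ball (0 : E) R).norm_image_sub_le_of_norm_hasFDerivWithin_le (𝕜 := ℂ)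
    (fun z hz => (h.hasFDerivAt s hs z hz).hasFDerivWithinAt) (fun _ hz => h.norm_deriv_le hs hz)
    hy hx

lemma norm_field_le (h : IsSmallField Y A R K) {s : ℝ} (hs : s ∈ Icc (0 : ℝ) 1) {x : E}
    (hx : x ∈ ball (0 : E) R) :
    ‖Y s x‖ ≤ 1 / 2 * ‖x‖ := by
  simpa [h.field_zero s hs] using h.norm_field_sub_le hs hx h.zero_mem

/-- The mean value inequality for `Y s - A s x` on the segment, where the derivative varies by at
most `K ‖y - x‖`. -/
lemma norm_remainder_le (h : IsSmallField Y A R K) {s : ℝ} (hs : s ∈ Icc (0 : ℝ) 1) {x y : E}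
    (hx : x ∈ ball (0 : E) R)
    (hy : y ∈ ball (0 : E) R) : ‖Y s y - Y s x - A s x (y - x)‖ ≤ K * ‖y - x‖ ^ 2 := by
  have hseg : segment ℝ x y ⊆ ball (0 : E) R := (convex_ball (0 : E) R).segment_subset hx hy
  have h1 := (convex_segment (𝕜 := ℝ) x y).norm_image_sub_le_of_norm_hasFDerivWithin_le'
    (𝕜 := ℂ) (f := Y s) (φ := A s x) (C := K * ‖y - x‖)
    (fun z hz => (h.hasFDerivAt s hs z (hseg hz)).hasFDerivWithinAt) (fun z hz => ?_)
    (left_mem_segment ℝ x y) (right_mem_segment ℝ x y)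
  · calc _ ≤ K * ‖y - x‖ * ‖y - x‖ := h1
      _ = _ := by ring
  · refine (h.lipschitz s hs z (hseg hz) x hx).trans ?_
    have := h.const_nonneg
    gcongr
    have h2 := norm_sub_le_of_mem_segment hz
    exact h2

lemma lipschitzOnWith (h : IsSmallField Y A R K) {s : ℝ} (hs : s ∈ Icc (0 : ℝ) 1) :
    LipschitzOnWith (1 / 2) (Y s) (ball (0 : E) R) :=
  LipschitzOnWith.of_dist_le_mul fun x hx y hy => by
    rw [dist_eq_norm, dist_eq_norm]
    simpa using h.norm_field_sub_le hs hx hy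

lemma closedBall_half_subset (h : IsSmallField Y A R K) :
    closedBall (0 : E) (R / 2) ⊆ ball (0 : E) R :=
  closedBall_subset_ball (half_lt_self h.radius_pos)

lemma exists_isFlow (h : IsSmallField Y A R K) [CompleteSpace E] :
    ∃ Z : ℝ → E → E, IsFlow Y R Z := by
  have hR := h.radius_pos
  have hsub := h.closedBall_half_subset
  -- On the ball of radius `R / 2` the speed is at most `R / 4`, so in unit time a point starting
  -- within `R / 4` cannot leave it.
  have hpl : IsPicardLindelof Y (⟨0, by simp⟩ : Icc (0 : ℝ) 1) 0 ⟨R / 2, by positivity⟩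
      ⟨R / 4, by positivity⟩ ⟨R / 4, by positivity⟩ (1 / 2) :=
    { lipschitzOnWith := fun s hs => (h.lipschitzOnWith hs).mono hsub
      continuousOn := fun x hx => h.continuousOn_field x (hsub hx)
      norm_le := fun s hs x hx => by
        have h1 := h.norm_field_le hs (hsub hx)
        have h2 : ‖x‖ ≤ R / 2 := mem_closedBall_zero_iff.mp hx
        change _ ≤ R / 4
        linarith
      mul_max_le := by
        change R / 4 * max ((1 : ℝ) - 0) (0 - 0) ≤ R / 2 - R / 4
        rw [sub_zero, sub_zero, max_eq_left zero_le_one]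
        linarith }
  have hex : ∀ x : E, ∃ α : ℝ → E, x ∈ closedBall (0 : E) (R / 4) → α 0 = x ∧
      ∀ t ∈ Icc (0 : ℝ) 1, α t ∈ closedBall (0 : E) (R / 2) ∧
        HasDerivWithinAt α (Y t (α t)) (Icc 0 1) t := by
    intro x
    by_cases hx : x ∈ closedBall (0 : E) (R / 4)
    · obtain ⟨α, hα⟩ := exists_solution_mem_closedBall hpl hx
      exact ⟨α, fun _ => hα⟩
    · exact ⟨fun _ => 0, fun hx' => absurd hx' hx⟩
  choose α hα using hex
  exact ⟨fun s x => α x s, fun x hx => (hα x hx).1, fun x hx s hs => ((hα x hx).2 s hs).1,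
    fun x hx s hs => ((hα x hx).2 s hs).2⟩

lemma flow_mem (h : IsSmallField Y A R K) (hZ : IsFlow Y R Z)
    {x : E} (hx : x ∈ closedBall (0 : E) (R / 4)) {s : ℝ} (hs : s ∈ Icc (0 : ℝ) 1) :
    Z s x ∈ ball (0 : E) R := h.closedBall_half_subset (hZ.mem x hx s hs)

lemma norm_flow_sub_le (h : IsSmallField Y A R K) (hZ : IsFlow Y R Z)
    {x y : E} (hx : x ∈ closedBall (0 : E) (R / 4))
    (hy : y ∈ closedBall (0 : E) (R / 4)) {s : ℝ} (hs : s ∈ Icc (0 : ℝ) 1) :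
    ‖Z s x - Z s y‖ ≤ Real.exp 1 * ‖x - y‖ := by
  have h1 := dist_le_of_trajectories_ODE_of_mem (v := Y) (s := fun _ => ball (0 : E) R)
    (K := 1 / 2) (a := 0) (b := 1) (f := fun s => Z s x) (g := fun s => Z s y) (δ := ‖x - y‖)
    (fun t ht => h.lipschitzOnWith ⟨ht.1, ht.2.le⟩)
    (hZ.continuousOn hx)
    (fun t ht => hasDerivWithinAt_Ici_of_Icc ht (hZ.deriv x hx t ⟨ht.1, ht.2.le⟩))
    (fun t ht => h.flow_mem hZ hx ⟨ht.1, ht.2.le⟩)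
    (hZ.continuousOn hy)
    (fun t ht => hasDerivWithinAt_Ici_of_Icc ht (hZ.deriv y hy t ⟨ht.1, ht.2.le⟩))
    (fun t ht => h.flow_mem hZ hy ⟨ht.1, ht.2.le⟩)
    (by rw [hZ.initial x hx, hZ.initial y hy, dist_eq_norm]) s hs
  rw [dist_eq_norm, mul_comm] at h1
  refine h1.trans ?_
  gcongr
  have := hs.2
  have := hs.1
  push_cast
  linarith

/-- Backward uniqueness: trajectories that meet at time `1` coincide back to time `0`. -/
lemma injOn_flow_one (h : IsSmallField Y A R K) (hZ : IsFlow Y R Z)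
    : InjOn (Z 1) (closedBall (0 : E) (R / 4)) := by
  intro x hx y hy hxy
  have h1 := ODE_solution_unique_of_mem_Icc_left (v := Y) (s := fun _ => ball (0 : E) R)
    (K := 1 / 2) (a := 0) (b := 1) (f := fun s => Z s x) (g := fun s => Z s y)
    (fun t ht => h.lipschitzOnWith ⟨ht.1.le, ht.2⟩)
    (hZ.continuousOn hx)
    (fun t ht => hasDerivWithinAt_Iic_of_Icc ht (hZ.deriv x hx t ⟨ht.1.le, ht.2⟩))
    (fun t ht => h.flow_mem hZ hx ⟨ht.1.le, ht.2⟩)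
    (hZ.continuousOn hy)
    (fun t ht => hasDerivWithinAt_Iic_of_Icc ht (hZ.deriv y hy t ⟨ht.1.le, ht.2⟩))
    (fun t ht => h.flow_mem hZ hy ⟨ht.1.le, ht.2⟩) hxy (show (0 : ℝ) ∈ Icc 0 1 by simp)
  simpa [hZ.initial x hx, hZ.initial y hy] using h1

lemma flow_zero (h : IsSmallField Y A R K) (hZ : IsFlow Y R Z)
    {s : ℝ} (hs : s ∈ Icc (0 : ℝ) 1) : Z s 0 = 0 := by
  have h0 : (0 : E) ∈ closedBall (0 : E) (R / 4) :=
    mem_closedBall_self (by linarith [h.radius_pos])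
  refine eq_zero_of_abs_deriv_le_mul_abs_self_of_eq_zero_right (f := fun s => Z s 0) (K := 1 / 2)
    (hZ.continuousOn h0)
    (fun t ht => hasDerivWithinAt_Ici_of_Icc ht (hZ.deriv 0 h0 t ⟨ht.1, ht.2.le⟩))
    (hZ.initial 0 h0) (fun t ht => ?_) s hs
  have ht' : t ∈ Icc (0 : ℝ) 1 := ⟨ht.1, ht.2.le⟩
  exact h.norm_field_le ht' (h.flow_mem hZ h0 ht')

/-- The speed is bounded by `R`; uniformity in `x` later yields uniform convergence of the shifts.
-/
lemma norm_flow_one_sub_le (h : IsSmallField Y A R K) (hZ : IsFlow Y R Z)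
    {x : E} (hx : x ∈ closedBall (0 : E) (R / 4)) {s : ℝ}
    (hs : s ∈ Icc (0 : ℝ) 1) : ‖Z 1 x - Z s x‖ ≤ R * (1 - s) := by
  have h1 := (convex_Icc (0 : ℝ) 1).norm_image_sub_le_of_norm_hasDerivWithin_le (C := R)
    (fun t ht => hZ.deriv x hx t ht) (fun t ht => ?_) hs (show (1 : ℝ) ∈ Icc 0 1 by simp)
  · rwa [Real.norm_of_nonneg (by linarith [hs.2])] at h1
  · have h2 := h.norm_field_le ht (h.flow_mem hZ hx ht)
    have h3 := mem_ball_zero_iff.mp (h.flow_mem hZ hx ht)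
    linarith [h.radius_pos]

/-! ### The variational equation -/

lemma continuousOn_deriv_flow (h : IsSmallField Y A R K) (hZ : IsFlow Y R Z)
    {x : E} (hx : x ∈ closedBall (0 : E) (R / 4)) :
    ContinuousOn (fun s => A s (Z s x)) (Icc 0 1) := by
  have h1 : ContinuousOn (fun p : E × ℝ => A p.2 p.1) (ball (0 : E) R ×ˢ Icc (0 : ℝ) 1) := by
    refine continuousOn_prod_of_continuousOn_lipschitzOnWith (fun p : E × ℝ => A p.2 p.1)
      ⟨K, h.const_nonneg⟩ (fun x hx => h.continuousOn_deriv x hx) fun s hs => ?_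
    exact LipschitzOnWith.of_dist_le_mul fun x hx y hy => by
      rw [dist_eq_norm, dist_eq_norm]; exact h.lipschitz s hs x hx y hy
  exact h1.comp ((hZ.continuousOn hx).prodMk continuousOn_id)
    fun s hs => ⟨h.flow_mem hZ hx hs, hs⟩

lemma exists_variational (h : IsSmallField Y A R K) (hZ : IsFlow Y R Z)
    [CompleteSpace E] {x : E} (hx : x ∈ closedBall (0 : E) (R / 4)) :
    ∃ W : ℝ → E →L[ℂ] E, W 0 = ContinuousLinearMap.id ℂ E ∧ ∀ s ∈ Icc (0 : ℝ) 1,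
      HasDerivWithinAt W ((A s (Z s x)).comp (W s)) (Icc 0 1) s := by
  have hA : ∀ s ∈ Icc (0 : ℝ) 1, ‖A s (Z s x)‖ ≤ 1 / 2 := fun s hs =>
    h.norm_deriv_le hs (h.flow_mem hZ hx hs)
  -- In the unit ball around the identity `‖W‖ ≤ 2`, so the linear field has norm at most `1 / 2 * 2
  -- = 1` and unit time suffices.
  have hpl : IsPicardLindelof (fun s (W : E →L[ℂ] E) => (A s (Z s x)).comp W)
      (⟨0, by simp⟩ : Icc (0 : ℝ) 1) (ContinuousLinearMap.id ℂ E) 1 0 1 (1 / 2) :=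
    { lipschitzOnWith := fun s hs => LipschitzOnWith.of_dist_le_mul fun V _ W _ => by
        rw [dist_eq_norm, dist_eq_norm, ← ContinuousLinearMap.comp_sub]
        refine (ContinuousLinearMap.opNorm_comp_le _ _).trans ?_
        have := hA s hs
        push_cast
        gcongr
      continuousOn := fun W _ => (h.continuousOn_deriv_flow hZ hx).clm_comp continuousOn_const
      norm_le := fun s hs W hW => by
        refine (ContinuousLinearMap.opNorm_comp_le _ _).trans ?_
        have h1 : ‖W‖ ≤ 2 := by
          have h2 : ‖W - ContinuousLinearMap.id ℂ E‖ ≤ 1 := mem_closedBall_iff_norm.mp hW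
          have h3 : ‖ContinuousLinearMap.id ℂ E‖ ≤ 1 := ContinuousLinearMap.norm_id_le
          calc ‖W‖ = ‖(W - ContinuousLinearMap.id ℂ E) + ContinuousLinearMap.id ℂ E‖ := by
                rw [sub_add_cancel]
            _ ≤ 2 := (norm_add_le _ _).trans (by linarith)
        calc ‖A s (Z s x)‖ * ‖W‖ ≤ 1 / 2 * 2 :=
              mul_le_mul (hA s hs) h1 (norm_nonneg _) (by norm_num)
          _ = ((1 : NNReal) : ℝ) := by norm_num
      mul_max_le := by simp }
  obtain ⟨W, hW0, hW⟩ := exists_solution_mem_closedBall hpl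
    (mem_closedBall_self (by simp) : ContinuousLinearMap.id ℂ E ∈ _)
  exact ⟨W, hW0, fun s hs => (hW s hs).2⟩

/-- The error solves the variational equation with the Taylor remainder of `Y` as inhomogeneity;
that is quadratic in the distance of the trajectories, and Grönwall's inequality keeps it quadratic
in `‖y - x‖`. -/
lemma norm_flow_sub_variational_le (h : IsSmallField Y A R K) (hZ : IsFlow Y R Z)
    {x y : E} (hx : x ∈ closedBall (0 : E) (R / 4))
    (hy : y ∈ closedBall (0 : E) (R / 4)) {W : ℝ → E →L[ℂ] E}
    (hW0 : W 0 = ContinuousLinearMap.id ℂ E) (hW : ∀ s ∈ Icc (0 : ℝ) 1,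
      HasDerivWithinAt W ((A s (Z s x)).comp (W s)) (Icc 0 1) s) {s : ℝ}
    (hs : s ∈ Icc (0 : ℝ) 1) :
    ‖Z s y - Z s x - W s (y - x)‖ ≤
      (K * Real.exp 1 ^ 2 * (2 * Real.exp 1)) * ‖y - x‖ ^ 2 := by
  set ε := K * (Real.exp 1 * ‖y - x‖) ^ 2 with hε
  have hε0 : 0 ≤ ε := mul_nonneg h.const_nonneg (by positivity)
  have hd : ∀ t ∈ Icc (0 : ℝ) 1, HasDerivWithinAt (fun s => Z s y - Z s x - W s (y - x))
      (Y t (Z t y) - Y t (Z t x) - A t (Z t x) (W t (y - x))) (Icc 0 1) t := fun t ht => by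
    refine ((hZ.deriv y hy t ht).sub (hZ.deriv x hx t ht)).sub ?_
    exact
      ((ContinuousLinearMap.apply ℂ E (y - x)).restrictScalars ℝ).hasFDerivAt.comp_hasDerivWithinAt
      t (hW t ht)
  have h1 := norm_le_gronwallBound_of_norm_deriv_right_le (a := 0) (b := 1) (δ := 0) (K := 1 / 2)
    (ε := ε) (f := fun s => Z s y - Z s x - W s (y - x))
    (fun t ht => (hd t ht).continuousWithinAt)
    (fun t ht => hasDerivWithinAt_Ici_of_Icc ht (hd t ⟨ht.1, ht.2.le⟩))
    (by simp [hZ.initial x hx, hZ.initial y hy, hW0]) (fun t ht => ?_) s hs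
  · refine h1.trans ?_
    rw [gronwallBound_of_K_ne_0 (by norm_num)]
    have h2 : Real.exp (1 / 2 * (s - 0)) ≤ Real.exp 1 := by
      refine Real.exp_le_exp.mpr ?_
      linarith [hs.1, hs.2]
    calc 0 * Real.exp (1 / 2 * (s - 0)) + ε / (1 / 2) * (Real.exp (1 / 2 * (s - 0)) - 1)
        = ε * 2 * (Real.exp (1 / 2 * (s - 0)) - 1) := by ring
      _ ≤ ε * 2 * Real.exp 1 := by gcongr; linarith
      _ = _ := by rw [hε]; ring
  · have ht' : t ∈ Icc (0 : ℝ) 1 := ⟨ht.1, ht.2.le⟩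
    have hx' := h.flow_mem hZ hx ht'
    have hy' := h.flow_mem hZ hy ht'
    have e : Y t (Z t y) - Y t (Z t x) - A t (Z t x) (W t (y - x)) =
        A t (Z t x) (Z t y - Z t x - W t (y - x)) +
          (Y t (Z t y) - Y t (Z t x) - A t (Z t x) (Z t y - Z t x)) := by
      rw [map_sub (A t (Z t x)) (Z t y - Z t x)]; abel
    rw [e]
    refine (norm_add_le _ _).trans (add_le_add ?_ ?_)
    · exact (ContinuousLinearMap.le_opNorm _ _).trans
        (mul_le_mul_of_nonneg_right (h.norm_deriv_le ht' hx') (norm_nonneg _))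
    · refine (h.norm_remainder_le ht' hx' hy').trans ?_
      have := h.const_nonneg
      have := h.norm_flow_sub_le hZ hy hx ht'
      rw [hε]
      gcongr

lemma hasFDerivAt_flow (h : IsSmallField Y A R K) (hZ : IsFlow Y R Z)
    {x : E} (hx : x ∈ ball (0 : E) (R / 4)) {W : ℝ → E →L[ℂ] E}
    (hW0 : W 0 = ContinuousLinearMap.id ℂ E) (hW : ∀ s ∈ Icc (0 : ℝ) 1,
      HasDerivWithinAt W ((A s (Z s x)).comp (W s)) (Icc 0 1) s) {s : ℝ}
    (hs : s ∈ Icc (0 : ℝ) 1) : HasFDerivAt (Z s) (W s) x := by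
  have h1 : (fun y => Z s y - Z s x - W s (y - x)) =O[𝓝 x] fun y => ‖y - x‖ ^ 2 := by
    refine Asymptotics.IsBigO.of_bound (K * Real.exp 1 ^ 2 * (2 * Real.exp 1)) ?_
    filter_upwards [isOpen_ball.mem_nhds hx] with y hy
    rw [Real.norm_of_nonneg (by positivity)]
    exact h.norm_flow_sub_variational_le hZ (ball_subset_closedBall hx)
      (ball_subset_closedBall hy) hW0 hW hs
  have h2 := Asymptotics.IsBigO.hasFDerivAt (𝕜 := ℂ) h1 one_lt_two
  have h3 := ((h2.add ((W s).hasFDerivAt.comp x ((hasFDerivAt_id x).sub_const x))).add_const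
    (Z s x))
  have h4 : Z s = fun y => (Z s y - Z s x - W s (y - x)) + W s (y - x) + Z s x := by
    funext y; abel
  rw [h4]
  refine h3.congr_fderiv ?_
  ext v; simp

lemma differentiableOn_flow (h : IsSmallField Y A R K) (hZ : IsFlow Y R Z)
    [CompleteSpace E] {s : ℝ} (hs : s ∈ Icc (0 : ℝ) 1) :
    DifferentiableOn ℂ (Z s) (ball (0 : E) (R / 4)) := fun x hx => by
  obtain ⟨W, hW0, hW⟩ := h.exists_variational hZ (ball_subset_closedBall hx)
  exact (h.hasFDerivAt_flow hZ hx hW0 hW hs).differentiableAt.differentiableWithinAt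

lemma fderiv_flow_zero (h : IsSmallField Y A R K) (hZ : IsFlow Y R Z)
    [CompleteSpace E] {s : ℝ} (hs : s ∈ Icc (0 : ℝ) 1) :
    fderiv ℂ (Z s) 0 = ContinuousLinearMap.id ℂ E := by
  have h0 : (0 : E) ∈ ball (0 : E) (R / 4) := mem_ball_self (by linarith [h.radius_pos])
  refine (h.hasFDerivAt_flow hZ h0 (W := fun _ => ContinuousLinearMap.id ℂ E) rfl
    (fun t ht => ?_) hs).fderiv
  rw [h.flow_zero hZ ht, h.deriv_zero t ht, ContinuousLinearMap.zero_comp]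
  exact hasDerivWithinAt_const _ _ _

/-- Along the variational equation the derivative of `σ (W u) (W v)` is the expression in `hσ`,
hence zero. -/
lemma bilin_fderiv_flow (h : IsSmallField Y A R K) (hZ : IsFlow Y R Z)
    [CompleteSpace E] (σ : E →L[ℂ] E →L[ℂ] ℂ)
    (hσ : ∀ s ∈ Icc (0 : ℝ) 1, ∀ x ∈ ball (0 : E) R, ∀ u v,
      σ (A s x u) v + σ u (A s x v) = 0) {s : ℝ} (hs : s ∈ Icc (0 : ℝ) 1) {x : E}
    (hx : x ∈ ball (0 : E) (R / 4)) (u v : E) :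
    σ (fderiv ℂ (Z s) x u) (fderiv ℂ (Z s) x v) = σ u v := by
  have hx' := ball_subset_closedBall hx
  obtain ⟨W, hW0, hW⟩ := h.exists_variational hZ hx'
  rw [(h.hasFDerivAt_flow hZ hx hW0 hW hs).fderiv]
  have hev : ∀ w : E, ∀ t ∈ Icc (0 : ℝ) 1,
      HasDerivWithinAt (fun t => W t w) (A t (Z t x) (W t w)) (Icc 0 1) t := fun w t ht =>
    ((ContinuousLinearMap.apply ℂ E w).restrictScalars ℝ).hasFDerivAt.comp_hasDerivWithinAt
      t (hW t ht)
  have hd : ∀ t ∈ Icc (0 : ℝ) 1, HasDerivWithinAt (fun t => σ (W t u) (W t v) - σ u v) 0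
      (Icc 0 1) t := fun t ht => by
    have h1 : HasDerivWithinAt (fun t => σ (W t u)) (σ (A t (Z t x) (W t u))) (Icc 0 1) t :=
      (σ.restrictScalars ℝ).hasFDerivAt.comp_hasDerivWithinAt t (hev u t ht)
    have h2 : HasDerivWithinAt (fun t => σ (W t u) (W t v))
        (σ (A t (Z t x) (W t u)) (W t v) + σ (W t u) (A t (Z t x) (W t v))) (Icc 0 1) t := by
      have hb := (isBoundedBilinearMap_apply (𝕜 := ℂ) (E := E) (F := ℂ)).hasFDerivAt
        (σ (W t u), W t v)
      have := (hb.restrictScalars ℝ).comp_hasDerivWithinAt t (h1.prodMk (hev v t ht))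
      refine this.congr_deriv ?_
      simp [add_comm]
    rw [hσ t ht _ (h.flow_mem hZ hx' ht)] at h2
    exact h2.sub_const _
  have := eq_zero_of_abs_deriv_le_mul_abs_self_of_eq_zero_right (K := 0)
    (f := fun t => σ (W t u) (W t v) - σ u v) (fun t ht => (hd t ht).continuousWithinAt)
    (fun t ht => hasDerivWithinAt_Ici_of_Icc ht (hd t ⟨ht.1, ht.2.le⟩)) (by simp [hW0])
    (by simp) s hs
  exact sub_eq_zero.mp this

end IsSmallField

end Flow

section HamiltonianField

variable {n : ℕ} {F G : Series n} {b c c' r : ℝ} {x : Phase n}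

/-! ### Hamiltonian vector fields of series -/

lemma pderiv_comm (i j : Var n) (F : Series n) :
    MvPowerSeries.pderiv ℂ i (MvPowerSeries.pderiv ℂ j F) =
      MvPowerSeries.pderiv ℂ j (MvPowerSeries.pderiv ℂ i F) := by
  ext k
  simp only [MvPowerSeries.coeff_pderiv]
  rw [add_right_comm k (Finsupp.single j 1)]
  by_cases h : i = j
  · rw [h]
  · simp [h, Ne.symm h]
    ring

/-- The sign with which the conjugate derivative enters the Hamiltonian field. -/
def hamSign (i : Var n) : ℂ := Sum.elim (fun _ => Complex.I) (fun _ => -Complex.I) i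

lemma norm_hamSign (i : Var n) : ‖hamSign i‖ = 1 := by
  rcases i with j | j <;> simp [hamSign]

lemma hamiltonianField_apply (F : Series n) (x : Phase n) (i : Var n) :
    hamiltonianField F x i = hamSign i * value (MvPowerSeries.pderiv ℂ i.swap F) x := by
  rcases i with j | j <;> rfl

lemma hamiltonianField_C_mul (a : ℂ) (F : Series n) (x : Phase n) :
    hamiltonianField (MvPowerSeries.C a * F) x = a • hamiltonianField F x := by
  funext i
  rw [Pi.smul_apply, hamiltonianField_apply, hamiltonianField_apply, pderiv_C_mul, value_C_mul,
    smul_eq_mul]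
  ring

/-- The derivative of the Hamiltonian vector field. -/
def hamiltonianDeriv (F : Series n) (x : Phase n) : Phase n →L[ℂ] Phase n :=
  ContinuousLinearMap.pi fun i => hamSign i • ∑ m,
    value (MvPowerSeries.pderiv ℂ m (MvPowerSeries.pderiv ℂ i.swap F)) x •
      (ContinuousLinearMap.proj m : Phase n →L[ℂ] ℂ)

lemma hamiltonianDeriv_apply (F : Series n) (x u : Phase n) (i : Var n) :
    hamiltonianDeriv F x u i = hamSign i * ∑ m,
      value (MvPowerSeries.pderiv ℂ m (MvPowerSeries.pderiv ℂ i.swap F)) x * u m := by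
  simp [hamiltonianDeriv, mul_add]

lemma CoeffBound.hasFDerivAt_hamiltonianField (h : CoeffBound c b F) (hb : 0 ≤ b) (hr : 0 < r)
    (hbr : 4 * b * r < 1) (hx : x ∈ Metric.ball (0 : Phase n) r) :
    HasFDerivAt (hamiltonianField F) (hamiltonianDeriv F x) x := by
  rw [hasFDerivAt_pi']
  intro i
  have h1 := ((h.pderiv hb i.swap).hasFDerivAt_value (by positivity) hr (by linarith) hx).const_mul
    (hamSign i)
  have h2 : (fun x => hamiltonianField F x i) =
      fun x => hamSign i * value (MvPowerSeries.pderiv ℂ i.swap F) x :=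
    funext fun x => hamiltonianField_apply F x i
  rw [h2]
  refine h1.congr_fderiv ?_
  ext u
  simp [hamiltonianDeriv_apply, mul_add]

lemma CoeffBound.norm_hamiltonianField_le (h : CoeffBound c b F) (hb : 0 ≤ b) (hr : 0 ≤ r)
    (hbr : 2 * b * r < 1) (hx : ∀ i, ‖x i‖ ≤ r) :
    ‖hamiltonianField F x‖ ≤ c * b * geom n (2 * b * r) := by
  refine (pi_norm_le_iff_of_nonneg (mul_nonneg (mul_nonneg h.nonneg hb)
    (geom_nonneg n (by positivity)))).mpr fun i => ?_
  rw [hamiltonianField_apply, norm_mul, norm_hamSign, one_mul]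
  exact (h.pderiv hb _).norm_value_le (by positivity) hr hbr hx

/-- Three derivatives of `F` enter, each doubling the rate, which explains `b`, `2 * b`, `4 * b` and
the final `8 * b`. One factor `2 * n` comes from the row sum, the other from the mean value
inequality. -/
lemma CoeffBound.norm_hamiltonianDeriv_sub_le (h : CoeffBound c b F) (hb : 0 ≤ b) (hr : 0 < r)
    (hbr : 8 * b * r < 1) {y : Phase n} (hx : x ∈ Metric.ball (0 : Phase n) r)
    (hy : y ∈ Metric.ball (0 : Phase n) r) :
    ‖hamiltonianDeriv F x - hamiltonianDeriv F y‖ ≤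
      2 * n * (2 * n * (c * b * (2 * b) * (4 * b) * geom n (8 * b * r))) * ‖x - y‖ := by
  have hc := h.nonneg
  have hg := geom_nonneg n (t := 8 * b * r) (by positivity)
  refine ContinuousLinearMap.opNorm_le_bound _ (by positivity) fun u => ?_
  refine (pi_norm_le_iff_of_nonneg (by positivity)).mpr fun i => ?_
  rw [sub_apply, Pi.sub_apply, hamiltonianDeriv_apply, hamiltonianDeriv_apply,
    ← mul_sub, norm_mul, norm_hamSign, one_mul, ← Finset.sum_sub_distrib]
  calc _ ≤ ∑ _m : Var n, 2 * n * (c * b * (2 * b) * (4 * b) * geom n (8 * b * r)) *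
        ‖x - y‖ * ‖u‖ := by
        refine norm_sum_le_of_le _ fun m _ => ?_
        rw [← sub_mul, norm_mul]
        have h1 := ((h.pderiv hb i.swap).pderiv (by positivity) m).norm_value_sub_le
          (by positivity) hr (by linarith) hx hy
        rw [show 2 * (2 * (2 * b)) * r = 8 * b * r by ring,
          show 2 * (2 * b) = 4 * b by ring] at h1
        exact mul_le_mul h1 (norm_le_pi_norm u m) (norm_nonneg _) (by positivity)
    _ = _ := by
        rw [Finset.sum_const, nsmul_eq_mul]
        simp [two_mul]
        ring

lemma hamiltonianField_zero (hF : F ∈ Cubic n) : hamiltonianField F 0 = 0 := by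
  funext i
  rw [hamiltonianField_apply, value_zero, MvPowerSeries.coeff_pderiv,
    hF _ (by simp [Finsupp.degree_single])]
  simp

lemma hamiltonianDeriv_zero (hF : F ∈ Cubic n) : hamiltonianDeriv F 0 = 0 := by
  ext u i
  rw [hamiltonianDeriv_apply, Finset.sum_eq_zero fun m _ => ?_]
  · simp
  · rw [value_zero, MvPowerSeries.coeff_pderiv, MvPowerSeries.coeff_pderiv,
      hF _ (by simp [map_add, Finsupp.degree_single])]
    simp

/-- The symplectic form as a continuous bilinear map. -/
def symplecticCLM (n : ℕ) : Phase n →L[ℂ] Phase n →L[ℂ] ℂ :=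
  ∑ j : Fin n, ((ContinuousLinearMap.proj (R := ℂ) (φ := fun _ : Var n => ℂ) (Sum.inr j)).smulRight
      (ContinuousLinearMap.proj (Sum.inl j) : Phase n →L[ℂ] ℂ) -
    (ContinuousLinearMap.proj (R := ℂ) (φ := fun _ : Var n => ℂ) (Sum.inl j)).smulRight
      (ContinuousLinearMap.proj (Sum.inr j) : Phase n →L[ℂ] ℂ))

lemma symplecticCLM_apply (u v : Phase n) : symplecticCLM n u v = symplecticForm u v := by
  simp [symplecticCLM, symplecticForm]

/-- The derivative of a Hamiltonian field is the symplectic matrix times the Hessian, and the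
Hessian is symmetric. -/
lemma symplecticForm_hamiltonianDeriv (F : Series n) (x u v : Phase n) :
    symplecticForm (hamiltonianDeriv F x u) v + symplecticForm u (hamiltonianDeriv F x v) = 0 := by
  set a : Var n → Var n → ℂ := fun i m =>
    value (MvPowerSeries.pderiv ℂ i (MvPowerSeries.pderiv ℂ m F)) x with ha
  have hsymm : ∀ i m, a i m = a m i := fun i m => by simp only [ha, pderiv_comm i m]
  have h1 : symplecticForm (hamiltonianDeriv F x u) v =
      -Complex.I * ∑ i, ∑ m, a m i * u m * v i := by
    rw [Fintype.sum_sum_type, ← Finset.sum_add_distrib, Finset.mul_sum, symplecticForm]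
    refine Finset.sum_congr rfl fun j _ => ?_
    rw [hamiltonianDeriv_apply, hamiltonianDeriv_apply, ← Finset.sum_mul, ← Finset.sum_mul]
    simp only [hamSign, Sum.elim_inl, Sum.elim_inr, Sum.swap_inl, Sum.swap_inr, ha]
    ring
  have h2 : symplecticForm u (hamiltonianDeriv F x v) =
      Complex.I * ∑ i, ∑ m, a m i * v m * u i := by
    rw [Fintype.sum_sum_type, ← Finset.sum_add_distrib, Finset.mul_sum, symplecticForm]
    refine Finset.sum_congr rfl fun j _ => ?_
    rw [hamiltonianDeriv_apply, hamiltonianDeriv_apply, ← Finset.sum_mul, ← Finset.sum_mul]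
    simp only [hamSign, Sum.elim_inl, Sum.elim_inr, Sum.swap_inl, Sum.swap_inr, ha]
    ring
  have h3 : ∑ i, ∑ m, a m i * v m * u i = ∑ i, ∑ m, a m i * u m * v i := by
    rw [Finset.sum_comm]
    refine Finset.sum_congr rfl fun i _ => Finset.sum_congr rfl fun m _ => ?_
    rw [hsymm i m]
    ring
  rw [h1, h2, h3]
  ring

lemma continuousOn_coeff_pderiv {S : Set ℝ} {Φ : ℝ → Series n}
    (hc : ∀ k, ContinuousOn (fun s => MvPowerSeries.coeff k (Φ s)) S) (i : Var n)
    (k : Var n →₀ ℕ) :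
    ContinuousOn (fun s => MvPowerSeries.coeff k (MvPowerSeries.pderiv ℂ i (Φ s))) S := by
  simp only [MvPowerSeries.coeff_pderiv]
  exact (hc _).mul continuousOn_const

/-- Uniformly bounded cubic Hamiltonians have small fields near the origin. -/
theorem exists_isSmallField {Φ : ℝ → Series n} (hb : 0 < b)
    (hΦ : ∀ s ∈ Icc (0 : ℝ) 1, CoeffBound c b (Φ s)) (hcub : ∀ s ∈ Icc (0 : ℝ) 1, Φ s ∈ Cubic n)
    (hcont : ∀ k, ContinuousOn (fun s => MvPowerSeries.coeff k (Φ s)) (Icc 0 1)) :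
    ∃ R K : ℝ, 16 * b * R ≤ 1 ∧ IsSmallField (fun s => hamiltonianField (Φ s))
      (fun s => hamiltonianDeriv (Φ s)) R K := by
  have hc : 0 ≤ c := (hΦ 0 (by simp)).nonneg
  -- The radius leaves room for all rates up to `8 * b` produced by three derivatives; `R` is then
  -- shrunk further so that `K * R ≤ 1 / 2`.
  set r := 1 / (16 * b) with hr
  have hr0 : 0 < r := by positivity
  have hbr : 16 * b * r = 1 := by rw [hr]; field_simp
  set K := 2 * n * (2 * n * (c * b * (2 * b) * (4 * b) * geom n (8 * b * r))) with hK
  have hK0 : 0 ≤ K := by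
    have := geom_nonneg n (t := 8 * b * r) (by positivity)
    positivity
  set R := min r (1 / (2 * (K + 1))) with hR
  have hR0 : 0 < R := lt_min hr0 (by positivity)
  have hRr : R ≤ r := min_le_left _ _
  have hsub : ∀ x ∈ Metric.ball (0 : Phase n) R, x ∈ Metric.ball (0 : Phase n) r :=
    fun x hx => Metric.ball_subset_ball hRr hx
  have hle : ∀ x ∈ Metric.ball (0 : Phase n) R, ∀ i, ‖x i‖ ≤ r := fun x hx i =>
    (norm_le_pi_norm x i).trans (mem_ball_zero_iff.mp (hsub x hx)).le
  have hbr' : ∀ m : ℝ, m < 16 → m * b * r < 1 := fun m hm => by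
    rw [← hbr]; gcongr
  refine ⟨R, K, ?_, hR0, hK0, fun s hs x hx => ?_, fun s hs => hamiltonianField_zero (hcub s hs),
    fun s hs => hamiltonianDeriv_zero (hcub s hs), fun s hs x hx y hy => ?_, ?_,
    fun x hx => ?_, fun x hx => ?_⟩
  · rw [← hbr]; gcongr
  · exact (hΦ s hs).hasFDerivAt_hamiltonianField hb.le hr0 (hbr' 4 (by norm_num)) (hsub x hx)
  · exact (hΦ s hs).norm_hamiltonianDeriv_sub_le hb.le hr0 (hbr' 8 (by norm_num)) (hsub x hx)
      (hsub y hy)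
  · calc K * R ≤ (K + 1) * (1 / (2 * (K + 1))) := by
          gcongr
          · linarith
          · exact min_le_right _ _
      _ = 1 / 2 := by field_simp
  · rw [continuousOn_pi]
    intro i
    simp only [hamiltonianField_apply]
    exact continuousOn_const.mul (continuousOn_value_of_coeffBound
      (fun s hs => (hΦ s hs).pderiv hb.le i.swap) (continuousOn_coeff_pderiv hcont i.swap)
      (by positivity) hr0.le (hbr' 2 (by norm_num)) (hle x hx))
  · rw [continuousOn_clm_apply]
    intro u
    rw [continuousOn_pi]
    intro i
    simp only [hamiltonianDeriv_apply]
    refine continuousOn_const.mul (continuousOn_finsetSum _ fun m _ => ContinuousOn.mul ?_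
      continuousOn_const)
    exact continuousOn_value_of_coeffBound
      (fun s hs => ((hΦ s hs).pderiv hb.le i.swap).pderiv (by positivity) m)
      (continuousOn_coeff_pderiv (continuousOn_coeff_pderiv hcont i.swap) m)
      (by positivity) hr0.le (by rw [← mul_assoc]; norm_num; exact hbr' 4 (by norm_num)) (hle x hx)

/-! ### Values of Poisson brackets -/

lemma CoeffBound.pderiv_mul_pderiv (hF : CoeffBound c b F) (hG : CoeffBound c' b G) (hb : 0 ≤ b)
    (i j : Var n) : CoeffBound (c * b * (c' * b)) (4 * b)
      (MvPowerSeries.pderiv ℂ i F * MvPowerSeries.pderiv ℂ j G) := by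
  have := (hF.pderiv hb i).mul (hG.pderiv hb j) (by positivity)
  rwa [show (2 : ℝ) * (2 * b) = 4 * b by ring] at this

lemma CoeffBound.poisson (hF : CoeffBound c b F) (hG : CoeffBound c' b G) (hb : 0 ≤ b) :
    CoeffBound (2 * n * (c * b * (c' * b))) (4 * b) (poisson F G) := by
  have h1 := fun i j => hF.pderiv_mul_pderiv hG hb i j
  have h2 := (CoeffBound.sum Finset.univ fun j _ =>
    (h1 (Sum.inr j) (Sum.inl j)).sub (h1 (Sum.inl j) (Sum.inr j))).C_mul Complex.I
  refine h2.mono (by positivity) (le_of_eq ?_) le_rfl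
  simp
  ring

lemma CoeffBound.value_poisson (hF : CoeffBound c b F) (hG : CoeffBound c' b G) (hb : 0 ≤ b)
    (hr : 0 ≤ r) (hbr : 4 * b * r < 1) (hx : ∀ i, ‖x i‖ ≤ r) :
    value (NormalizationFlow.poisson F G) x = Complex.I * ∑ j,
      (value (MvPowerSeries.pderiv ℂ (Sum.inr j) F) x *
          value (MvPowerSeries.pderiv ℂ (Sum.inl j) G) x -
        value (MvPowerSeries.pderiv ℂ (Sum.inl j) F) x *
          value (MvPowerSeries.pderiv ℂ (Sum.inr j) G) x) := by
  have hbr2 : 2 * b * r < 1 := by nlinarith [mul_nonneg hb hr]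
  have h1 := fun i j => hF.pderiv_mul_pderiv hG hb i j
  have h2 : ∀ i j, value (MvPowerSeries.pderiv ℂ i F * MvPowerSeries.pderiv ℂ j G) x =
      value (MvPowerSeries.pderiv ℂ i F) x * value (MvPowerSeries.pderiv ℂ j G) x := fun i j =>
    (hF.pderiv hb i).value_mul (hG.pderiv hb j) (by positivity) hr hbr2 hx
  rw [NormalizationFlow.poisson, value_C_mul, CoeffBound.value_sum Finset.univ (fun j _ =>
    (h1 (Sum.inr j) (Sum.inl j)).sub (h1 (Sum.inl j) (Sum.inr j))) (by positivity) hr hbr hx]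
  congr 1
  refine Finset.sum_congr rfl fun j _ => ?_
  rw [sub_eq_add_neg, (h1 _ _).value_add (h1 _ _).neg (by positivity) hr hbr hx, value_neg, h2, h2,
    ← sub_eq_add_neg]

lemma CoeffBound.X (i : Var n) : CoeffBound 1 1 (MvPowerSeries.X i : Series n) := fun k => by
  classical
  rw [MvPowerSeries.coeff_X, one_pow, mul_one]
  split_ifs <;> simp

lemma coeffBound_quadratic (ω : Fin n → ℝ) : CoeffBound (∑ j, |ω j|) 2 (quadratic ω) := by
  refine CoeffBound.sum _ fun j _ => ?_
  have := ((CoeffBound.X (Sum.inl j)).C_mul (ω j : ℂ)).mul (CoeffBound.X (Sum.inr j)) zero_le_one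
  simpa using this

end HamiltonianField

section Conjugation

variable {n : ℕ} {b c c' r : ℝ}

/-! ### Conservation of the transported Hamiltonian -/

/-- Chain rule for the value of a varying series along a curve. -/
lemma hasDerivAt_value_curve {H H' : ℝ → Series n} {z z' : ℝ → Phase n} {L : ℝ} {S : Set ℝ}
    (hS : IsOpen S) (hS' : IsPreconnected S) (hb : 0 ≤ b) (hr : 0 < r) (hbr : 2 * b * r < 1)
    (hH : ∀ t ∈ S, CoeffBound c b (H t)) (hH' : ∀ t ∈ S, CoeffBound c' b (H' t))
    (hd : ∀ t ∈ S, ∀ k, HasDerivAt (fun s => MvPowerSeries.coeff k (H s))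
      (MvPowerSeries.coeff k (H' t)) t)
    (hz : ∀ t ∈ S, ∀ i, ‖z t i‖ ≤ r) (hz' : ∀ t ∈ S, ‖z' t‖ ≤ L)
    (hzd : ∀ t ∈ S, HasDerivAt z (z' t) t) {t : ℝ} (ht : t ∈ S) :
    HasDerivAt (fun s => value (H s) (z s)) (value (H' t) (z t) +
      ∑ i, value (MvPowerSeries.pderiv ℂ i (H t)) (z t) * z' t i) t := by
  have hbr1 : b * r < 1 := by nlinarith [mul_nonneg hb hr.le]
  have hsum := summable_pow_degree (ι := Var n) (mul_nonneg hb hr.le) hbr1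
  have hsum2 := summable_pow_degree (ι := Var n) (t := 2 * b * r) (by positivity) hbr
  have hL : 0 ≤ L := (norm_nonneg _).trans (hz' t ht)
  have hterm : ∀ k, ∀ t ∈ S, HasDerivAt (fun s => term (H s) (z s) k)
      (term (H' t) (z t) k + ∑ i, termDeriv (H t) (z t) k i * z' t i) t := by
    intro k t ht
    have h1 := ((hasFDerivAt_monomial k (z t)).restrictScalars ℝ).comp_hasDerivAt t (hzd t ht)
    refine ((hd t ht k).mul h1).congr_deriv ?_
    rw [term]
    congr 1
    simp only [ContinuousLinearMap.coe_restrictScalars', sum_apply, smul_apply,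
      ContinuousLinearMap.proj_apply, smul_eq_mul, termDeriv, Finset.mul_sum, mul_assoc]
  have hbound : ∀ k, ∀ t ∈ S, ‖term (H' t) (z t) k + ∑ i, termDeriv (H t) (z t) k i * z' t i‖ ≤
      c' * (b * r) ^ k.degree + c / r * (2 * b * r) ^ k.degree * L := by
    intro k t ht
    refine (norm_add_le _ _).trans (add_le_add ((hH' t ht).norm_term_le hb (hz t ht) k) ?_)
    refine le_trans ?_ (mul_le_mul_of_nonneg_right
      ((hH t ht).norm_term_deriv_le hb hr (hz t ht) k) hL)
    rw [Finset.sum_mul]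
    refine norm_sum_le_of_le _ fun i _ => ?_
    rw [norm_mul]
    exact mul_le_mul_of_nonneg_left ((norm_le_pi_norm _ i).trans (hz' t ht)) (norm_nonneg _)
  have hs : ∀ i, Summable fun k => termDeriv (H t) (z t) k i := fun i =>
    Summable.of_norm_bounded (hsum2.mul_left (c / r)) fun k =>
      (Finset.single_le_sum (f := fun i => ‖termDeriv (H t) (z t) k i‖)
        (fun _ _ => norm_nonneg _) (Finset.mem_univ i)).trans
        ((hH t ht).norm_term_deriv_le hb hr (hz t ht) k)
  have key := hasDerivAt_tsum_of_isPreconnected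
    ((hsum.mul_left c').add ((hsum2.mul_left (c / r)).mul_right L)) hS hS' hterm hbound ht
    ((hH t ht).summable_term hb hr.le hbr1 (hz t ht)) ht
  refine key.congr_deriv ?_
  rw [((hH' t ht).summable_term hb hr.le hbr1 (hz t ht)).tsum_add
    (summable_sum fun i _ => (hs i).mul_right _),
    Summable.tsum_finsetSum fun i _ => (hs i).mul_right _]
  congr 1
  refine Finset.sum_congr rfl fun i _ => ?_
  rw [(hs i).tsum_mul_right, value_pderiv]

lemma sum_pderiv_mul_hamiltonianField {F H : Series n} {x : Phase n} (hF : CoeffBound c b F)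
    (hH : CoeffBound c' b H) (hb : 0 ≤ b) (hr : 0 ≤ r) (hbr : 4 * b * r < 1)
    (hx : ∀ i, ‖x i‖ ≤ r) :
    ∑ i, value (MvPowerSeries.pderiv ℂ i H) x * hamiltonianField F x i =
      value (poisson F H) x := by
  rw [hF.value_poisson hH hb hr hbr hx, Fintype.sum_sum_type, ← Finset.sum_add_distrib,
    Finset.mul_sum]
  refine Finset.sum_congr rfl fun j _ => ?_
  simp only [hamiltonianField, Sum.elim_inl, Sum.elim_inr]
  ring

/-- If `∂ H = -{F, H}` then `H` is constant along the trajectories of the Hamiltonian `F`. -/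
theorem value_eq_of_transport {F H : ℝ → Series n} {z : ℝ → Phase n}
    (hb : 0 ≤ b) (hr : 0 < r) (hbr : 16 * b * r ≤ 1)
    (hF : ∀ t, 0 ≤ t → CoeffBound c b (F t)) (hH : ∀ t, 0 ≤ t → CoeffBound c' b (H t))
    (hd : ∀ t, 0 ≤ t → ∀ k, HasDerivAt (fun s => MvPowerSeries.coeff k (H s))
      (MvPowerSeries.coeff k (-poisson (F t) (H t))) t)
    (hz : ∀ t, 0 ≤ t → ∀ i, ‖z t i‖ ≤ r)
    (hzd : ∀ t, 0 ≤ t → HasDerivWithinAt z (hamiltonianField (F t) (z t)) (Ici 0) t)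
    {t : ℝ} (ht : 0 ≤ t) : value (H t) (z t) = value (H 0) (z 0) := by
  have hbr0 : 0 ≤ b * r := mul_nonneg hb hr.le
  have hc' := (hH 0 le_rfl).nonneg
  have hderiv : ∀ s ∈ Ioi (0 : ℝ), HasDerivAt (fun s => value (H s) (z s)) 0 s := by
    intro s hs
    refine (hasDerivAt_value_curve (H' := fun t => -poisson (F t) (H t))
      (z' := fun t => hamiltonianField (F t) (z t)) isOpen_Ioi isPreconnected_Ioi
      -- The bracket is controlled only at the rate `4 * b`, so this rate is used for both series.
      (show 0 ≤ 4 * b by positivity) hr (by linarith)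
      (fun t ht => (hH t (le_of_lt ht)).mono hb le_rfl (by linarith))
      (fun t ht => ((hF t (le_of_lt ht)).poisson (hH t (le_of_lt ht)) hb).neg)
      (fun t ht => hd t (le_of_lt ht)) (fun t ht => hz t (le_of_lt ht))
      (fun t ht => (hF t (le_of_lt ht)).norm_hamiltonianField_le hb hr.le (by linarith)
        (hz t (le_of_lt ht)))
      (fun t ht => (hzd t (le_of_lt ht)).hasDerivAt (Ici_mem_nhds ht)) hs).congr_deriv ?_
    have hs' : 0 ≤ s := le_of_lt hs
    rw [sum_pderiv_mul_hamiltonianField (hF s hs') (hH s hs') hb hr.le (by linarith) (hz s hs'),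
      value_neg, neg_add_cancel]
  have hconst : ∀ s ∈ Ioi (0 : ℝ), value (H s) (z s) = value (H 1) (z 1) := fun s hs =>
    isOpen_Ioi.is_const_of_deriv_eq_zero isPreconnected_Ioi
      (fun s hs => (hderiv s hs).differentiableAt.differentiableWithinAt)
      (fun s hs => (hderiv s hs).deriv) hs (mem_Ioi.mpr one_pos)
  -- Termwise differentiation needs an open time set, so constancy is known only for positive times;
  -- continuity carries it to `0`.
  have hcont : ContinuousOn (fun s => value (H s) (z s)) (Ici 0) := by
    refine continuousOn_tsum (fun k => ContinuousOn.mul (fun s hs => ?_) (fun s hs => ?_))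
      ((summable_pow_degree (mul_nonneg hb hr.le) (by linarith)).mul_left c')
      fun k s hs => (hH s hs).norm_term_le hb (hz s hs) k
    · exact (hd s hs k).continuousAt.continuousWithinAt
    · exact (hasFDerivAt_monomial k (z s)).continuousAt.comp_continuousWithinAt
        (hzd s hs).continuousWithinAt
  have h0 : value (H 0) (z 0) = value (H 1) (z 1) := by
    have h1 := ((hcont 0 self_mem_Ici).mono Ioi_subset_Ici_self).tendsto
    have h2 : Tendsto (fun s => value (H s) (z s)) (𝓝[>] (0 : ℝ)) (𝓝 (value (H 1) (z 1))) :=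
      tendsto_const_nhds.congr' (by
        filter_upwards [self_mem_nhdsWithin] with s hs using (hconst s hs).symm)
    exact tendsto_nhds_unique h1 h2
  rcases ht.eq_or_lt with rfl | ht
  · rfl
  · rw [h0, hconst t ht]

end Conjugation

section Reparametrization

variable {n : ℕ} {b C κ : ℝ} {F : ℝ → Series n}

/-! ### The time change `s = 1 - exp (-a δ)` -/

/-- The Hamiltonian `F` in the time `s = 1 - exp (-a δ)`, extended by zero to `s = 1`. -/
def compactified (a : ℝ) (F : ℝ → Series n) (s : ℝ) : Series n :=
  if s < 1 then MvPowerSeries.C ((1 / (a * (1 - s)) : ℝ) : ℂ) * F (-Real.log (1 - s) / a) else 0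

/-- With the halved rate `a = κ / 2` the decay `exp (-κ δ)` is `(1 - s) ^ 2`. Dividing by the time
derivative `a (1 - s)` leaves one factor `1 - s`, which gives continuity at `s = 1`. -/
lemma norm_coeff_compactified_le (hκ : 0 < κ) (hF : ∀ δ, 0 ≤ δ →
    CoeffBound (C * Real.exp (-κ * δ)) b (F δ)) {s : ℝ} (hs : s ∈ Icc (0 : ℝ) 1)
    (k : Var n →₀ ℕ) : ‖MvPowerSeries.coeff k (compactified (κ / 2) F s)‖ ≤
      C / (κ / 2) * b ^ k.degree * (1 - s) := by
  unfold compactified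
  split_ifs with h
  · have h1 : 0 < 1 - s := by linarith
    have hδ : 0 ≤ -Real.log (1 - s) / (κ / 2) :=
      div_nonneg (neg_nonneg.mpr (Real.log_nonpos h1.le (by linarith [hs.1]))) (by positivity)
    have h2 : Real.exp (-κ * (-Real.log (1 - s) / (κ / 2))) = (1 - s) * (1 - s) := by
      rw [show -κ * (-Real.log (1 - s) / (κ / 2)) = Real.log (1 - s) + Real.log (1 - s) by
        field_simp; ring, Real.exp_add, Real.exp_log h1]
    have h3 := hF _ hδ k
    rw [h2] at h3
    rw [MvPowerSeries.coeff_C_mul, norm_mul, Complex.norm_real, Real.norm_of_nonneg (by positivity)]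
    calc _ ≤ 1 / (κ / 2 * (1 - s)) * (C * ((1 - s) * (1 - s)) * b ^ k.degree) := by gcongr
      _ = _ := by field_simp
  · have : s = 1 := le_antisymm hs.2 (not_lt.mp h)
    simp [this]

lemma coeffBound_compactified (hb : 0 ≤ b) (hκ : 0 < κ) (hF : ∀ δ, 0 ≤ δ →
    CoeffBound (C * Real.exp (-κ * δ)) b (F δ)) {s : ℝ} (hs : s ∈ Icc (0 : ℝ) 1) :
    CoeffBound (C / (κ / 2)) b (compactified (κ / 2) F s) := fun k => by
  refine (norm_coeff_compactified_le hκ hF hs k).trans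
    (mul_le_of_le_one_right ?_ (by linarith [hs.1]))
  have hC : 0 ≤ C := by simpa using (hF 0 le_rfl).nonneg
  positivity

lemma continuousOn_coeff_compactified (hκ : 0 < κ) (hF : ∀ δ, 0 ≤ δ →
    CoeffBound (C * Real.exp (-κ * δ)) b (F δ)) (k : Var n →₀ ℕ)
    (hc : Continuous fun δ => MvPowerSeries.coeff k (F δ)) :
    ContinuousOn (fun s => MvPowerSeries.coeff k (compactified (κ / 2) F s)) (Icc 0 1) := by
  intro s hs
  rcases hs.2.lt_or_eq with h | rfl
  · have h1 : 1 - s ≠ 0 := by linarith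
    have h2 : ContinuousAt (fun s : ℝ => ((1 / (κ / 2 * (1 - s)) : ℝ) : ℂ) *
        MvPowerSeries.coeff k (F (-Real.log (1 - s) / (κ / 2)))) s := by
      refine ContinuousAt.mul ?_ ?_
      · refine Complex.continuous_ofReal.continuousAt.comp ?_
        refine continuousAt_const.div (by fun_prop) (by positivity)
      · refine ContinuousAt.comp (g := fun δ => MvPowerSeries.coeff k (F δ)) hc.continuousAt ?_
        refine ContinuousAt.div_const (ContinuousAt.neg ?_) _
        exact ContinuousAt.log (by fun_prop) h1
    refine (h2.congr ?_).continuousWithinAt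
    filter_upwards [Iio_mem_nhds h] with t ht
    rw [compactified, if_pos (mem_Iio.mp ht), MvPowerSeries.coeff_C_mul]
  · rw [ContinuousWithinAt]
    have h0 : MvPowerSeries.coeff k (compactified (κ / 2) F 1) = 0 := by simp [compactified]
    rw [h0]
    refine squeeze_zero_norm' (a := fun s => C / (κ / 2) * b ^ k.degree * (1 - s)) ?_ ?_
    · filter_upwards [self_mem_nhdsWithin] with s hs using norm_coeff_compactified_le hκ hF hs k
    · have : Tendsto (fun s : ℝ => C / (κ / 2) * b ^ k.degree * (1 - s)) (𝓝 1)
          (𝓝 (C / (κ / 2) * b ^ k.degree * (1 - 1))) := by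
        refine Continuous.tendsto ?_ _
        fun_prop
      rw [sub_self, mul_zero] at this
      exact this.mono_left nhdsWithin_le_nhds

/-- The time `s = 1 - exp (-a δ)`. -/
def compactTime (a δ : ℝ) : ℝ := 1 - Real.exp (-a * δ)

lemma compactTime_lt_one (a δ : ℝ) : compactTime a δ < 1 := by
  have := Real.exp_pos (-a * δ)
  unfold compactTime; linarith

lemma compactTime_mem {a δ : ℝ} (ha : 0 ≤ a) (hδ : 0 ≤ δ) : compactTime a δ ∈ Icc (0 : ℝ) 1 := by
  refine ⟨?_, (compactTime_lt_one a δ).le⟩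
  have : Real.exp (-a * δ) ≤ 1 := Real.exp_le_one_iff.mpr (by nlinarith)
  unfold compactTime; linarith

lemma hasDerivAt_compactTime (a δ : ℝ) :
    HasDerivAt (compactTime a) (a * Real.exp (-a * δ)) δ := by
  refine (((hasDerivAt_id δ).const_mul (-a)).exp.const_sub 1).congr_deriv ?_
  simp; ring

lemma compactified_compactTime {a : ℝ} (ha : 0 < a) (F : ℝ → Series n) (δ : ℝ) :
    compactified a F (compactTime a δ) =
      MvPowerSeries.C ((1 / (a * Real.exp (-a * δ)) : ℝ) : ℂ) * F δ := by
  rw [compactified, if_pos (compactTime_lt_one a δ), compactTime, sub_sub_cancel, Real.log_exp]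
  congr 2
  field_simp

lemma compactified_mem_cubic {a : ℝ} (hF : ∀ δ, F δ ∈ Cubic n) (s : ℝ) :
    compactified a F s ∈ Cubic n := fun k hk => by
  unfold compactified
  split_ifs
  · rw [MvPowerSeries.coeff_C_mul, hF _ k hk, mul_zero]
  · simp

end Reparametrization

section Shift

variable {n : ℕ} {b c C κ R K a : ℝ} {F : ℝ → Series n} {Z : ℝ → Phase n → Phase n}

/-! ### The shifts along the Hamiltonian system -/

lemma CoeffBound.mem_analyticOnPolydisk {H : Series n} (h : CoeffBound c b H) (hb : 0 ≤ b)
    (hR : 0 ≤ R) (hbR : b * R < 1) : H ∈ AnalyticOnPolydisk n R := by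
  refine ⟨fun x hx => h.summable_term hb hR hbR fun i => (hx i).le, ?_⟩
  refine lt_of_le_of_lt (iSup₂_le fun x hx => ?_) (ENNReal.ofReal_lt_top (r := c * geom n (b * R)))
  rw [← ofReal_norm]
  exact ENNReal.ofReal_le_ofReal (h.norm_value_le hb hR hbR fun i => (hx i).le)

lemma tendsto_polydiskNorm {D : ℝ → Series n} (hκ : 0 < κ)
    (hD : ∀ δ, 0 ≤ δ → CoeffBound (C * Real.exp (-κ * δ)) b (D δ)) (hb : 0 ≤ b) (hR : 0 ≤ R)
    (hbR : b * R < 1) : Tendsto (fun δ => polydiskNorm R (D δ)) atTop (𝓝 0) := by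
  have h1 : Tendsto (fun δ => ENNReal.ofReal (C * Real.exp (-κ * δ) * geom n (b * R))) atTop
      (𝓝 0) := by
    rw [← ENNReal.ofReal_zero]
    refine (ENNReal.continuous_ofReal.tendsto 0).comp ?_
    have h2 : Tendsto (fun δ => Real.exp (-κ * δ)) atTop (𝓝 0) :=
      Real.tendsto_exp_atBot.comp (tendsto_id.const_mul_atTop_of_neg (neg_lt_zero.mpr hκ))
    simpa using (h2.const_mul C).mul_const (geom n (b * R))
  refine tendsto_of_tendsto_of_tendsto_of_le_of_le' tendsto_const_nhds h1
    (Eventually.of_forall fun _ => zero_le) ?_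
  filter_upwards [eventually_ge_atTop 0] with δ hδ
  refine iSup₂_le fun x hx => ?_
  rw [← ofReal_norm]
  exact ENNReal.ofReal_le_ofReal ((hD δ hδ).norm_value_le hb hR hbR fun i => (hx i).le)

/-- The chain-rule factor `a * exp (-a δ)` cancels the normalization in `compactified`. -/
lemma isHamiltonianShift_compactTime (ha : 0 < a)
    (h : IsSmallField (fun s => hamiltonianField (compactified a F s))
      (fun s => hamiltonianDeriv (compactified a F s)) R K)
    (hZ : IsFlow (fun s => hamiltonianField (compactified a F s)) R Z) :
    IsHamiltonianShift F (R / 4) R fun δ => Z (compactTime a δ) := by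
  have hR := h.radius_pos
  have hR4 : 0 < R / 4 := by positivity
  have hcb : ∀ x ∈ polydisk n (R / 4), x ∈ Metric.closedBall (0 : Phase n) (R / 4) := fun x hx => by
    rw [polydisk_eq_ball hR4] at hx
    exact Metric.ball_subset_closedBall hx
  refine ⟨fun x hx => ?_, fun x hx δ hδ => ?_, fun x hx δ hδ => ?_⟩
  · simpa [compactTime] using hZ.initial x (hcb x hx)
  · rw [polydisk_eq_ball hR]
    exact h.flow_mem hZ (hcb x hx) (compactTime_mem ha.le hδ)
  · have h1 := (hZ.deriv x (hcb x hx) _ (compactTime_mem ha.le hδ)).scomp δ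
      (hasDerivAt_compactTime a δ).hasDerivWithinAt
      (fun t (ht : t ∈ Ici (0 : ℝ)) => compactTime_mem ha.le ht)
    refine h1.congr_deriv ?_
    rw [compactified_compactTime ha, hamiltonianField_C_mul, ← Complex.coe_smul, smul_smul,
      ← Complex.ofReal_mul]
    have : a * Real.exp (-a * δ) ≠ 0 := by positivity
    rw [mul_one_div_cancel this, Complex.ofReal_one, one_smul]

lemma tendstoUniformlyOn_compactTime (ha : 0 < a)
    {Y : ℝ → Phase n → Phase n} {A : ℝ → Phase n → Phase n →L[ℂ] Phase n}
    (h : IsSmallField Y A R K) (hZ : IsFlow Y R Z) :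
    TendstoUniformlyOn (fun δ => Z (compactTime a δ)) (Z 1) atTop
      (Metric.ball (0 : Phase n) (R / 4)) := by
  rw [Metric.tendstoUniformlyOn_iff]
  intro ε hε
  have h2 : Tendsto (fun δ => R * Real.exp (-a * δ)) atTop (𝓝 (R * 0)) :=
    (Real.tendsto_exp_atBot.comp
      (tendsto_id.const_mul_atTop_of_neg (neg_lt_zero.mpr ha))).const_mul R
  rw [mul_zero] at h2
  filter_upwards [eventually_ge_atTop 0, h2.eventually_lt_const hε] with δ hδ hlt x hx
  rw [dist_eq_norm]
  refine (h.norm_flow_one_sub_le hZ (Metric.ball_subset_closedBall hx)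
    (compactTime_mem ha.le hδ)).trans_lt ?_
  rwa [compactTime, sub_sub_cancel]

lemma isAnalyticCanonical_flow_one {Φ : ℝ → Series n}
    (h : IsSmallField (fun s => hamiltonianField (Φ s)) (fun s => hamiltonianDeriv (Φ s)) R K)
    (hZ : IsFlow (fun s => hamiltonianField (Φ s)) R Z) :
    IsAnalyticCanonical (Z 1) (Metric.ball (0 : Phase n) (R / 4)) where
  analytic := analyticOnNhd_of_differentiableOn Metric.isOpen_ball
    (h.differentiableOn_flow hZ ⟨zero_le_one, le_rfl⟩)
  injective := (h.injOn_flow_one hZ).mono Metric.ball_subset_closedBall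
  symplectic x hx u v := by
    have := h.bilin_fderiv_flow hZ (symplecticCLM n) (fun s _ x _ u v => by
      rw [symplecticCLM_apply, symplecticCLM_apply]
      exact symplecticForm_hamiltonianDeriv _ x u v) ⟨zero_le_one, le_rfl⟩ hx u v
    rwa [symplecticCLM_apply, symplecticCLM_apply] at this

end Shift

end NormalizationFlow

end

/-! ### The proposition -/

open NormalizationFlow in
theorem mainTheorem7 (n : ℕ) (ω : Fin n → ℝ)
    (hω : NormalizationFlow.Nonresonant ω)
    (H₀ : NormalizationFlow.Series n)
    (hS : ∀ q ∈ NormalizationFlow.support H₀, 0 ≤ NormalizationFlow.pairing ω q)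
    (hA : H₀ ∈ NormalizationFlow.Analytic n)
    (hF : H₀ ∈ NormalizationFlow.Cubic n)
    (hc : 0 < NormalizationFlow.smallDivisorInf ω H₀) :
    ∃ γ : ℝ → NormalizationFlow.Series n,
      -- `γ` is the orbit of the normalization flow through `H₀`
      NormalizationFlow.IsNormalizationOrbit ω H₀ γ ∧
      (∀ γ' : ℝ → NormalizationFlow.Series n,
        NormalizationFlow.IsNormalizationOrbit ω H₀ γ' → ∀ δ : ℝ, 0 ≤ δ → γ' δ = γ δ) ∧
      ∃ R : ℝ, 0 < R ∧
        -- the orbit is analytic in a fixed polydisk, and there it tends to the normal form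
        (∀ δ : ℝ, 0 ≤ δ → γ δ ∈ NormalizationFlow.AnalyticOnPolydisk n R) ∧
        NormalizationFlow.harmonic 0 H₀ ∈ NormalizationFlow.AnalyticOnPolydisk n R ∧
        Tendsto (fun δ => NormalizationFlow.polydiskNorm R
          (γ δ - NormalizationFlow.harmonic 0 H₀)) atTop (𝓝 0) ∧
        ∃ ρ : ℝ, 0 < ρ ∧ ρ ≤ R ∧
          ∃ (Z : ℝ → NormalizationFlow.Phase n → NormalizationFlow.Phase n)
            (T : NormalizationFlow.Phase n → NormalizationFlow.Phase n),
            -- the shifts `Z δ` along the Hamiltonian system with Hamiltonian `ξ (γ δ)`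
            -- converge uniformly to `T` as `δ → +∞`
            NormalizationFlow.IsHamiltonianShift
              (fun δ => NormalizationFlow.xi ω (γ δ)) ρ R Z ∧
            TendstoUniformlyOn Z T atTop (NormalizationFlow.polydisk n ρ) ∧
            -- `T` is an analytic canonical near-identity transformation
            NormalizationFlow.IsAnalyticCanonical T (NormalizationFlow.polydisk n ρ) ∧
            T 0 = 0 ∧ fderiv ℂ T 0 = ContinuousLinearMap.id ℂ (NormalizationFlow.Phase n) ∧
            -- `T` brings the Hamiltonian to its normal form
            (∀ x ∈ NormalizationFlow.polydisk n ρ,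
              T x ∈ NormalizationFlow.polydisk n R ∧
              NormalizationFlow.value (NormalizationFlow.quadratic ω + H₀) x =
                NormalizationFlow.value
                  (NormalizationFlow.quadratic ω + NormalizationFlow.harmonic 0 H₀) (T x)) := by
  obtain ⟨C, b₀, κ, hb₀, hκ, hN₀, hG₀⟩ := exists_coeffBound_orbit hA hF hS hc
  set γ := orbit ω H₀ with hγ
  set N := harmonic 0 H₀ with hNdef
  -- `coeffBound_quadratic` has rate `2`; the maximum gives all the series a common rate.
  set b := max b₀ 2 with hbdef
  have hb : 0 < b := hb₀.trans_le (le_max_left _ _)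
  have hN : CoeffBound C b N := hN₀.mono hb₀.le le_rfl (le_max_left _ _)
  have hG : ∀ δ : ℝ, 0 ≤ δ → CoeffBound (C * Real.exp (-κ * δ)) b (γ δ - N) := fun δ hδ =>
    (hG₀ δ hδ).mono hb₀.le le_rfl (le_max_left _ _)
  have hQ : CoeffBound (∑ j, |ω j|) b (quadratic ω) :=
    (coeffBound_quadratic ω).mono zero_le_two le_rfl (le_max_right _ _)
  have hC := hN.nonneg
  have hγb : ∀ δ : ℝ, 0 ≤ δ → CoeffBound (C + C) b (γ δ) := fun δ hδ => by
    have h1 := (hG δ hδ).add hN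
    rw [sub_add_cancel] at h1
    refine h1.mono hb.le (add_le_add_left (mul_le_of_le_one_right hC ?_) _) le_rfl
    exact Real.exp_le_one_iff.mpr (by nlinarith)
  have hξ : ∀ δ : ℝ, 0 ≤ δ → CoeffBound (C * Real.exp (-κ * δ)) b (xi ω (γ δ)) := fun δ hδ => by
    rw [hγ, xi_orbit hω hS]
    simpa using (hG δ hδ).C_mul (-Complex.I)
  have hξ' : ∀ δ : ℝ, 0 ≤ δ → CoeffBound C b (xi ω (γ δ)) := fun δ hδ =>
    (hξ δ hδ).mono hb.le (mul_le_of_le_one_right hC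
      (Real.exp_le_one_iff.mpr (by nlinarith))) le_rfl
  have hcont : ∀ k, Continuous fun δ => MvPowerSeries.coeff k (xi ω (γ δ)) := fun k => by
    simp only [coeff_xi]
    exact continuous_const.mul (continuous_iff_continuousAt.mpr fun δ =>
      (hasDerivAt_coeff_orbit hF k δ).continuousAt)
  have hcub : ∀ δ, xi ω (γ δ) ∈ Cubic n := fun δ => xi_mem_cubic (orbit_mem_cubic hF δ)
  have ha : 0 < κ / 2 := by positivity
  obtain ⟨R, K, hbR, hsmall⟩ := exists_isSmallField hb
    (fun s hs => coeffBound_compactified hb.le hκ hξ hs)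
    (fun s _ => compactified_mem_cubic hcub s)
    (fun k => continuousOn_coeff_compactified hκ hξ k (hcont k))
  obtain ⟨Z, hZ⟩ := hsmall.exists_isFlow
  have hR := hsmall.radius_pos
  have hR4 : 0 < R / 4 := by positivity
  have hbR0 : 0 ≤ b * R := by positivity
  have hbR1 : b * R < 1 := by linarith
  have horbit := isNormalizationOrbit_orbit hω hS hF
  have hshift := isHamiltonianShift_compactTime ha hsmall hZ
  have hunif := tendstoUniformlyOn_compactTime ha hsmall hZ
  have h1mem : (1 : ℝ) ∈ Icc (0 : ℝ) 1 := ⟨zero_le_one, le_rfl⟩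
  refine ⟨γ, horbit, fun γ' hγ' δ hδ => horbit.unique hγ' hδ, R, hR,
    fun δ hδ => (hγb δ hδ).mem_analyticOnPolydisk hb.le hR.le hbR1,
    hN.mem_analyticOnPolydisk hb.le hR.le hbR1,
    tendsto_polydiskNorm hκ hG hb.le hR.le hbR1, R / 4, hR4, by linarith,
    fun δ => Z (compactTime (κ / 2) δ), Z 1, hshift, ?_, ?_, hsmall.flow_zero hZ h1mem,
    hsmall.fderiv_flow_zero hZ h1mem, fun x hx => ?_⟩
  · rw [polydisk_eq_ball hR4]; exact hunif
  · rw [polydisk_eq_ball hR4]; exact isAnalyticCanonical_flow_one hsmall hZ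
  have hxb : x ∈ Metric.ball (0 : Phase n) (R / 4) := by rwa [← polydisk_eq_ball hR4]
  have hTx : Z 1 x ∈ Metric.ball (0 : Phase n) R :=
    hsmall.flow_mem hZ (Metric.ball_subset_closedBall hxb) h1mem
  refine ⟨by rwa [polydisk_eq_ball hR], ?_⟩
  have hcons : ∀ δ, 0 ≤ δ → value (quadratic ω + γ δ) (Z (compactTime (κ / 2) δ) x) =
      value (quadratic ω + H₀) x := fun δ hδ => by
    have := value_eq_of_transport (F := fun δ => xi ω (γ δ)) (H := fun δ => quadratic ω + γ δ)
      (z := fun δ => Z (compactTime (κ / 2) δ) x) hb.le hR hbR hξ'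
      (fun t ht => hQ.add (hγb t ht)) (fun t _ k => by
        simp only [map_add (MvPowerSeries.coeff k) (quadratic ω)]
        rw [hγ, coeff_neg_poisson_orbit hω hS]
        exact (hasDerivAt_coeff_orbit hF k t).const_add _)
      (fun t ht i => (hshift.mem_polydisk x hx t ht i).le)
      (fun t ht => hshift.equation x hx t ht) hδ
    have hγ₀ : γ 0 = H₀ := orbit_zero ω H₀
    simpa only [hshift.initial x hx, hγ₀] using this
  have hlim : Tendsto (fun δ => value (quadratic ω + N) (Z (compactTime (κ / 2) δ) x)) atTop
      (𝓝 (value (quadratic ω + N) (Z 1 x))) :=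
    ((hQ.add hN).hasFDerivAt_value hb.le hR (by linarith) hTx).continuousAt.tendsto.comp
      (hunif.tendsto_at hxb)
  -- By conservation the difference is minus the value of `γ δ - N` at a point of the polydisk,
  -- which decays exponentially wherever the trajectory is.
  have hlim2 : Tendsto (fun δ => value (quadratic ω + N) (Z (compactTime (κ / 2) δ) x)) atTop
      (𝓝 (value (quadratic ω + H₀) x)) := by
    rw [← tendsto_sub_nhds_zero_iff]
    have h2 : Tendsto (fun δ => C * Real.exp (-κ * δ) * geom n (b * R)) atTop (𝓝 0) := by
      have h3 : Tendsto (fun δ => Real.exp (-κ * δ)) atTop (𝓝 0) :=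
        Real.tendsto_exp_atBot.comp (tendsto_id.const_mul_atTop_of_neg (neg_lt_zero.mpr hκ))
      simpa using (h3.const_mul C).mul_const (geom n (b * R))
    refine squeeze_zero_norm' ?_ h2
    filter_upwards [eventually_ge_atTop 0] with δ hδ
    have hz : ∀ i, ‖Z (compactTime (κ / 2) δ) x i‖ ≤ R := fun i =>
      (hshift.mem_polydisk x hx δ hδ i).le
    have h4 : quadratic ω + γ δ = (quadratic ω + N) + (γ δ - N) := by abel
    rw [← hcons δ hδ, h4, (hQ.add hN).value_add (hG δ hδ) hb.le hR.le hbR1 hz, sub_add_cancel_left,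
      norm_neg]
    exact (hG δ hδ).norm_value_le hb.le hR.le hbR1 hz
  exact tendsto_nhds_unique hlim2 hlim
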